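/- Let $U$ be a finite-dimensional real Euclidean space and let $K\subset U$ be a knot, i.e. the image of a smooth embedding $\gamma: S^1\to U$, with $0\notin K$. Let $\ell\ge 1$ be an integer and let $\mathcal Q_\ell(U)$ be the space of symmetric $\ell$-linear forms on $U$, with the inner product induced by that of $U$, $$\langle\Phi,\Psi\rangle_\ell=\sum_{i_1,\dots,i_\ell}\Phi(e_{i_1},\dots,e_{i_\ell})\,\Psi(e_{i_1},\dots,e_{i_\ell}),$$ where $(e_i)$ is an orthonormal basis of $U$. Let $\mathcal S^\ell$ be its unit sphere, with area measure $dS$. For $\Phi\in\mathcal Q_\ell(U)$ put $P_\Phi(u)=\Phi(u,\dots,u)$, and let $\mu_K^\ell(\Phi)$ be the number of critical points of the restriction $P_\Phi|_K$. Let $\mathcal V_\ell:U\to\mathcal Q_\ell(U)$ be the Veronese map, determined by $\langle\Phi,\mathcal V_\ell(u)\rangle_\ell=\Phi(u,\dots,u)$ for all $\Phi\in\mathcal Q_\ell(U)$ and $u\in U$. Then the restriction $\mathcal V_\ell|_K:K\to\mathcal Q_\ell(U)$ is a smooth immersion, $\mu_K^\ell(\Phi)$ is finite for almost all $\Phi\in\mathcal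 S^\ell$ and integrable over $\mathcal S^\ell$, and $$\frac{1}{\operatorname{area}(\mathcal S^\ell)}\int_{\mathcal S^\ell}\mu_K^\ell(\Phi)\,dS(\Phi)=\frac{1}{\pi}\,\tau_\ell(K),$$ where $\tau_\ell(K)=\int\kappa\,ds$ is the total curvature of the immersed closed curve $\mathcal V_\ell|_K$ ($\kappa$ its curvature, $ds$ its arclength element). For $\ell=1$, $\tau_1(K)$ is the total curvature of $K$ itself, so that the formula is the theorem of Fáry and Milnor. -/

import Mathlib

open MeasureTheory Manifold
open scoped ContDiff

noncomputable section

namespace VeroneseKnot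

/-- The subspace of symmetric forms inside the space of all `ℓ`-linear forms on `U`. -/
def symForms (ℓ : ℕ) (U : Type*) [NormedAddCommGroup U] [InnerProductSpace ℝ U] :
    Submodule ℝ (MultilinearMap ℝ (fun _ : Fin ℓ => U) ℝ) where
  carrier := {Φ | ∀ (σ : Equiv.Perm (Fin ℓ)) (v : Fin ℓ → U), Φ (fun i => v (σ i)) = Φ v}
  add_mem' := by
    intro Φ Ψ hΦ hΨ σ v
    rw [add_apply, add_apply, hΦ σ v, hΨ σ v]
  zero_mem' := by
    intro σ v
    rfl
  smul_mem' := by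
    intro c Φ hΦ σ v
    rw [smul_apply, smul_apply, hΦ σ v]

/-- `Q_ℓ(U)`, the space of symmetric `ℓ`-linear forms on `U`. -/
abbrev SymForm (ℓ : ℕ) (U : Type*) [NormedAddCommGroup U] [InnerProductSpace ℝ U] : Type _ :=
  symForms ℓ U

section SymForm

variable {ℓ : ℕ} {U : Type*} [NormedAddCommGroup U] [InnerProductSpace ℝ U]
  [FiniteDimensional ℝ U]

/-- The inner product of forms induced by the Euclidean metric of `U`: in an orthonormal basis
`e` of `U`, the sum of `Φ(e_{i₁},…,e_{i_ℓ}) Ψ(e_{i₁},…,e_{i_ℓ})` over all multi-indices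
`(i₁,…,i_ℓ)`, i.e. the restriction of the inner product of the `ℓ`-th tensor power of the
dual of `U`. -/
@[reducible]
def symFormCore (ℓ : ℕ) (U : Type*) [NormedAddCommGroup U] [InnerProductSpace ℝ U]
    [FiniteDimensional ℝ U] : InnerProductSpace.Core ℝ (SymForm ℓ U) where
  inner Φ Ψ := ∑ i : Fin ℓ → Fin (Module.finrank ℝ U),
    Φ.1 (fun k => stdOrthonormalBasis ℝ U (i k)) * Ψ.1 (fun k => stdOrthonormalBasis ℝ U (i k))
  conj_inner_symm Φ Ψ := by
    simp [mul_comm]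
  re_inner_nonneg Φ := by
    simpa using Finset.sum_nonneg fun i _ => mul_self_nonneg _
  add_left Φ Ψ Θ := by
    simp [add_mul, Finset.sum_add_distrib]
  smul_left Φ Ψ c := by
    simp [Finset.mul_sum, mul_assoc]
  definite Φ h := by
    have h0 := (Finset.sum_eq_zero_iff_of_nonneg fun i _ => mul_self_nonneg _).1 h
    apply Subtype.ext
    refine Module.Basis.ext_multilinear (fun _ => (stdOrthonormalBasis ℝ U).toBasis) fun i => ?_
    simpa using h0 i (Finset.mem_univ _)

instance : NormedAddCommGroup (SymForm ℓ U) :=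
  (symFormCore ℓ U).toNormedAddCommGroup

instance : InnerProductSpace ℝ (SymForm ℓ U) :=
  InnerProductSpace.ofCore (symFormCore ℓ U).toCore

instance : FiniteDimensional ℝ (SymForm ℓ U) :=
  inferInstanceAs (FiniteDimensional ℝ (symForms ℓ U))

instance : MeasurableSpace (SymForm ℓ U) := borel _

instance : BorelSpace (SymForm ℓ U) := ⟨rfl⟩

/-- Evaluation of forms on the diagonal, `Φ ↦ Φ(u,…,u)`. -/
def diagEval (ℓ : ℕ) (u : U) : SymForm ℓ U →ₗ[ℝ] ℝ where
  toFun Φ := Φ.1 (fun _ => u)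
  map_add' _ _ := rfl
  map_smul' _ _ := rfl

/-- The homogeneous polynomial `P_Φ(u) = Φ(u,…,u)` of a form. -/
def formPoly (Φ : SymForm ℓ U) (u : U) : ℝ := diagEval ℓ u Φ

/-- The Veronese map: `veronese ℓ u` is the form with `⟨veronese ℓ u, Φ⟩ = Φ(u,…,u)` for all
`Φ`. -/
def veronese (ℓ : ℕ) (u : U) : SymForm ℓ U :=
  (InnerProductSpace.toDual ℝ (SymForm ℓ U)).symm (diagEval ℓ u).toContinuousLinearMap

theorem inner_veronese (u : U) (Φ : SymForm ℓ U) :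
    inner ℝ Φ (veronese ℓ u) = Φ.1 (fun _ => u) := by
  rw [real_inner_comm, veronese, InnerProductSpace.toDual_symm_apply]
  rfl

/-- The set of points of the knot `K = γ(S¹)` which are critical for the restriction of `f`
to `K`. -/
def criticalPoints (γ : Circle → U) (f : U → ℝ) : Set U :=
  γ '' {z | mfderiv (𝓡 1) 𝓘(ℝ, ℝ) (f ∘ γ) z = 0}

/-- The area measure on the unit sphere of `Q_ℓ(U)`. -/
def sphereArea (ℓ : ℕ) (U : Type*) [NormedAddCommGroup U] [InnerProductSpace ℝ U]
    [FiniteDimensional ℝ U] : Measure (Metric.sphere (0 : SymForm ℓ U) 1) :=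
  (volume : Measure (SymForm ℓ U)).toSphere

/-- The expected number of critical points on `K = γ(S¹)` of `P_Φ`, for `Φ` uniformly distributed
on the unit sphere of `Q_ℓ(U)`. -/
def expectedCriticalPoints (ℓ : ℕ) (γ : Circle → U) : ℝ :=
  ((sphereArea ℓ U).real Set.univ)⁻¹ *
    ∫ Φ, ((criticalPoints γ (formPoly Φ.1)).ncard : ℝ) ∂(sphereArea ℓ U)

end SymForm

section Curvature

variable {E : Type*} [NormedAddCommGroup E] [InnerProductSpace ℝ E]

/-- The unit tangent vector of a parametrized curve. -/
def unitTangent (c : ℝ → E) (t : ℝ) : E := ‖deriv c t‖⁻¹ • deriv c t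

/-- The curvature of a parametrized curve: the norm of the derivative of the unit tangent vector
with respect to arclength. -/
def curvature (c : ℝ → E) (t : ℝ) : ℝ := ‖deriv (unitTangent c) t‖ / ‖deriv c t‖

/-- The total curvature `∫ κ ds` of an immersion `β : S¹ → E`, where `ds` is the arclength
element; it is computed in the parametrization `t ↦ β(exp(it))`, `0 ≤ t ≤ 2π`. -/
def totalCurvature (β : Circle → E) : ℝ :=
  ∫ t in (0 : ℝ)..(2 * Real.pi),
    curvature (fun s => β (Circle.exp s)) t * ‖deriv (fun s => β (Circle.exp s)) t‖

end Curvature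

end VeroneseKnot

end

/-! Since `P_Φ(γ) = ⟨Φ, V(γ)⟩`, where `V` is the Veronese map, a point of the knot is critical for
`P_Φ` exactly when `Φ` is orthogonal to the velocity of the Veronese curve, that is, to its unit
tangent `T` (`criticalPoints_eq_image`). So the critical points are the intersections of the tangent
indicatrix `T` with the great hypersphere orthogonal to `Φ`. The length of `T` is the total
curvature (`totalCurvature_eq_integral_norm_deriv`), and the theorem is Crofton's formula for `T`
(`crofton_sphere`).

Crofton's formula is proved by inscribed polygons. For two unit vectors, the proportion of forms `Φ`
taking opposite signs on them is their angle over `π`: along a great circle this proportion is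
additive and rotation invariant (`toSphere_real_signChange`). Summing over a dyadic partition, the
mean number of sign changes of `⟨Φ, T⟩` is the length of the inscribed geodesic polygon over `π`.
Under refinement these lengths tend to the length of `T` (`tendsto_sum_angle`), while for almost
every `Φ` the sign changes increase to the number of zeros, because almost surely all zeros are
simple and no dyadic point is a zero. Monotone convergence gives the formula, with finiteness and
integrability.

The Veronese curve is regular because pairing `V(u)` with powers of linear forms detects every
tangent direction when `u ≠ 0` (`deriv_veronese_comp_ne_zero`). -/

namespace VeroneseKnot

/-! ### Area on the unit sphere: invariance and thin equatorial bands -/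

section SphereMeasure

open Set Metric

variable {E : Type*} [NormedAddCommGroup E] [InnerProductSpace ℝ E] [FiniteDimensional ℝ E]
  [MeasurableSpace E] [BorelSpace E]

/-- The area of a part of the unit sphere, as a multiple of the volume of the cone over it. -/
theorem toSphere_preimage {S : Set E} (hS : MeasurableSet S) :
    (volume : Measure E).toSphere ((↑) ⁻¹' S) = Module.finrank ℝ E *
      volume {x : E | ‖x‖ < 1 ∧ x ≠ 0 ∧ ‖x‖⁻¹ • x ∈ S} := by
  rw [Measure.toSphere_apply' _ (measurable_subtype_coe hS)]
  congr 2
  ext x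
  simp only [Set.mem_smul, Set.mem_Ioo, Set.mem_image, Set.mem_preimage, Subtype.exists,
    mem_sphere_iff_norm, sub_zero, exists_and_left, exists_prop, exists_eq_right_right,
    Set.mem_ofPred_eq]
  constructor
  · rintro ⟨r, ⟨h0, h1⟩, y, ⟨hy, hn⟩, rfl⟩
    have hr : ‖r • y‖ = r := by rw [norm_smul, hn, mul_one, Real.norm_of_nonneg h0.le]
    refine ⟨hr.trans_lt h1, ?_, ?_⟩
    · rw [← norm_pos_iff, hr]; exact h0
    · rwa [hr, smul_smul, inv_mul_cancel₀ h0.ne', one_smul]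
  · rintro ⟨h1, h0, hx⟩
    have hp : 0 < ‖x‖ := norm_pos_iff.2 h0
    refine ⟨‖x‖, ⟨hp, h1⟩, ‖x‖⁻¹ • x, ⟨hx, ?_⟩, ?_⟩
    · rw [norm_smul, norm_inv, norm_norm, inv_mul_cancel₀ hp.ne']
    · rw [smul_smul, mul_inv_cancel₀ hp.ne', one_smul]

/-- A linear isometry carries cones to cones and preserves both norm and volume. -/
theorem toSphere_preimage_isometry (L : E ≃ₗᵢ[ℝ] E) {S : Set E} (hS : MeasurableSet S) :
    (volume : Measure E).toSphere ((↑) ⁻¹' (L ⁻¹' S)) =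
      (volume : Measure E).toSphere ((↑) ⁻¹' S) := by
  rw [toSphere_preimage hS, toSphere_preimage (L.continuous.measurable hS)]
  congr 1
  rw [← L.measurePreserving.measure_preimage_equiv (f := L.toMeasurableEquiv)
    {x : E | ‖x‖ < 1 ∧ x ≠ 0 ∧ ‖x‖⁻¹ • x ∈ S}]
  congr 1
  ext x
  simp

/-- The volume of the part of the unit ball in a slab is at most proportional to its width. -/
theorem volume_ball_inter_slab_le {a : E} (ha : ‖a‖ = 1) {η : ℝ} (hη : 0 < η) :
    volume {x : E | ‖x‖ < 1 ∧ |inner ℝ x a| ≤ η} ≤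
      ENNReal.ofReal η * volume (ball (0 : E) 7) := by
  set S := {x : E | ‖x‖ < 1 ∧ |inner ℝ x a| ≤ η} with hSdef
  have hSm : MeasurableSet S := by
    apply MeasurableSet.inter
    · exact measurableSet_lt measurable_norm measurable_const
    · exact measurableSet_le (by fun_prop : Measurable fun x : E => |inner ℝ x a|)
        measurable_const
  have hS7 : S ⊆ ball (0 : E) 7 := fun x hx => by
    rw [mem_ball_zero_iff]; linarith [hx.1]
  rcases le_total 1 η with h1 | h1
  · calc volume S ≤ 1 * volume (ball (0 : E) 7) := by rw [one_mul]; exact measure_mono hS7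
      _ ≤ _ := by gcongr; exact ENNReal.one_le_ofReal.2 h1
  set m := ⌈1 / η⌉₊ with hm
  have hm1 : 1 / η ≤ m := Nat.le_ceil _
  have hm2 : (m : ℝ) < 1 / η + 1 := Nat.ceil_lt_add_one (by positivity)
  -- The slab has width `2η`, so its translates by multiples of `3η` along `a` are disjoint. With `η
  -- ≤ 1` the roughly `1/η` translates shift by at most `6`, so they all fit in the ball of radius
  -- `7`.
  have hdisj : (↑(Finset.range m) : Set ℕ).PairwiseDisjoint
      (fun k : ℕ => (fun x => (-(3 * η * k)) • a + x) ⁻¹' S) := by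
    intro k _ j _ hkj
    rw [Function.onFun, Set.disjoint_left]
    rintro x ⟨-, hx⟩ ⟨-, hy⟩
    simp only [inner_add_left, inner_smul_left, real_inner_self_eq_norm_sq, ha] at hx hy
    simp only [map_neg, conj_trivial, one_pow, mul_one] at hx hy
    rw [abs_le] at hx hy
    apply hkj
    rcases lt_trichotomy k j with h | h | h
    · have : (k : ℝ) + 1 ≤ j := by exact_mod_cast h
      nlinarith
    · exact h
    · have : (j : ℝ) + 1 ≤ k := by exact_mod_cast h
      nlinarith
  have hsub : (⋃ k ∈ Finset.range m, (fun x => (-(3 * η * k)) • a + x) ⁻¹' S) ⊆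
      ball (0 : E) 7 := by
    intro x hx
    simp only [Set.mem_iUnion, Finset.mem_range] at hx
    obtain ⟨k, hk, hx, -⟩ := hx
    have hk' : (k : ℝ) ≤ m := by exact_mod_cast hk.le
    have h3 : 3 * η * k ≤ 6 := by
      have : η * k ≤ η * (1 / η + 1) := by gcongr; linarith
      rw [mul_add, mul_one_div_cancel hη.ne'] at this
      linarith
    rw [mem_ball_zero_iff]
    calc ‖x‖ = ‖((-(3 * η * k)) • a + x) + (3 * η * k) • a‖ := by congr 1; module
      _ ≤ ‖(-(3 * η * k)) • a + x‖ + ‖(3 * η * k) • a‖ := norm_add_le _ _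
      _ < 1 + 6 := by
        rw [norm_smul, ha, Real.norm_of_nonneg (by positivity)]
        linarith
      _ = 7 := by norm_num
  have hsum : m * volume S ≤ volume (ball (0 : E) 7) := by
    refine le_trans (le_of_eq ?_) (measure_mono hsub)
    rw [measure_biUnion_finset hdisj fun k _ => measurable_const_add _ hSm]
    simp [measure_preimage_add]
  calc volume S = ENNReal.ofReal η * (ENNReal.ofReal (1 / η) * volume S) := by
        rw [← mul_assoc, ← ENNReal.ofReal_mul hη.le, mul_one_div_cancel hη.ne',
          ENNReal.ofReal_one, one_mul]
    _ ≤ ENNReal.ofReal η * (m * volume S) := by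
        gcongr
        rw [← ENNReal.ofReal_natCast]
        exact ENNReal.ofReal_le_ofReal hm1
    _ ≤ _ := by gcongr

/-- The area of an equatorial band of the unit sphere is at most proportional to its width. -/
theorem toSphere_band_le {a : E} (ha : ‖a‖ = 1) {η : ℝ} (hη : 0 < η) :
    (volume : Measure E).toSphere {Φ : sphere (0 : E) 1 | |inner ℝ (Φ : E) a| ≤ η} ≤
      ENNReal.ofReal η * (Module.finrank ℝ E * volume (ball (0 : E) 7)) := by
  have hm : MeasurableSet {x : E | |inner ℝ x a| ≤ η} :=
    measurableSet_le (by fun_prop) measurable_const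
  refine (toSphere_preimage hm).trans_le ?_
  rw [mul_left_comm]
  gcongr
  refine le_trans (measure_mono ?_) (volume_ball_inter_slab_le ha hη)
  rintro x ⟨h1, h0, hx⟩
  refine ⟨h1, ?_⟩
  have hp : 0 < ‖x‖ := norm_pos_iff.2 h0
  simp only [Set.mem_ofPred_eq, inner_smul_left, conj_trivial, abs_mul, abs_inv, abs_norm] at hx
  rw [inv_mul_le_iff₀ hp] at hx
  exact hx.trans (mul_le_of_le_one_left hη.le h1.le)

/-- A great hypersphere lies in bands of arbitrarily small width, hence of arbitrarily small area.
-/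
theorem ae_toSphere_inner_ne_zero {a : E} (ha : ‖a‖ = 1) :
    ∀ᵐ Φ : sphere (0 : E) 1 ∂(volume : Measure E).toSphere, inner ℝ (Φ : E) a ≠ 0 := by
  set C := Module.finrank ℝ E * volume (ball (0 : E) 7) with hC
  have hCtop : C ≠ ⊤ := ENNReal.mul_ne_top (by simp) measure_ball_lt_top.ne
  have h : ∀ η : ℝ, 0 < η → (volume : Measure E).toSphere
      {Φ : sphere (0 : E) 1 | ¬ inner ℝ (Φ : E) a ≠ 0} ≤
      ENNReal.ofReal η * C := fun η hη => by
    refine le_trans (measure_mono fun Φ hΦ => ?_) (toSphere_band_le ha hη)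
    simp only [ne_eq, not_not, Set.mem_ofPred_eq] at hΦ ⊢
    simpa [hΦ] using hη.le
  have ht : Filter.Tendsto (fun η : ℝ => ENNReal.ofReal η * C) (nhdsWithin 0 (Ioi 0))
      (nhds (ENNReal.ofReal 0 * C)) :=
    (ENNReal.Tendsto.mul_const (ENNReal.continuous_ofReal.tendsto 0) (Or.inr hCtop)).mono_left
      nhdsWithin_le_nhds
  have := ge_of_tendsto ht (Filter.eventually_of_mem self_mem_nhdsWithin h)
  simpa [ae_iff] using this

end SphereMeasure

/-! ### Measure of the forms separating two unit vectors -/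

section SignChange

open Set Metric

/-- A nonnegative function which is additive on `[0, b]` is linear there. -/
theorem eq_div_mul_of_additive_of_nonneg {g : ℝ → ℝ} {b : ℝ} (hb : 0 < b)
    (hadd : ∀ x y, 0 ≤ x → 0 ≤ y → x + y ≤ b → g (x + y) = g x + g y)
    (hnn : ∀ x, 0 ≤ g x) {θ : ℝ} (h0 : 0 ≤ θ) (hθ : θ ≤ b) : g θ = θ / b * g b := by
  have hmono : ∀ x y, 0 ≤ x → x ≤ y → y ≤ b → g x ≤ g y := fun x y hx hxy hy => by
    have := hadd x (y - x) hx (by linarith) (by linarith)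
    rw [add_sub_cancel] at this
    linarith [hnn (y - x)]
  have hz : g 0 = 0 := by
    have := hadd 0 0 le_rfl le_rfl (by linarith)
    rw [add_zero] at this
    linarith
  have hmul : ∀ (k : ℕ) (x : ℝ), 0 ≤ x → k * x ≤ b → g (k * x) = k * g x := by
    intro k x hx
    induction k with
    | zero => intro _; simp [hz]
    | succ k ih =>
      intro hk
      push_cast at hk ⊢
      rw [add_mul, one_mul] at hk
      rw [add_mul, one_mul, hadd _ _ (by positivity) hx hk, ih (by linarith)]
      ring
  -- Rounding `θ` down to a multiple of `b / N` costs at most `g (b / N) = g b / N` on either side,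
  -- by monotonicity.
  have key : ∀ n : ℕ, |g θ - θ / b * g b| ≤ g b / ((n : ℝ) + 1) := by
    intro n
    set N : ℝ := (n : ℝ) + 1 with hN
    have hNpos : 0 < N := by positivity
    set x := b / N with hx
    have hxpos : 0 < x := by positivity
    have hgx : g b = N * g x := by
      have h := hmul (n + 1) x hxpos.le (by push_cast; rw [← hN, hx]; field_simp; exact le_rfl)
      push_cast at h
      rw [← hN] at h
      rw [← h, hx]
      congr 1
      field_simp
    set k := ⌊θ / x⌋₊ with hk
    have hk1 : k * x ≤ θ := (le_div_iff₀ hxpos).1 (Nat.floor_le (by positivity))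
    have hk2 : θ < (k + 1) * x := (div_lt_iff₀ hxpos).1 (Nat.lt_floor_add_one _)
    set r := θ - k * x with hr
    have hr0 : 0 ≤ r := by linarith
    have hrx : r ≤ x := by linarith
    have hxb : x ≤ b := by
      rw [hx, div_le_iff₀ hNpos]
      nlinarith [hb, (Nat.cast_nonneg n : (0 : ℝ) ≤ n)]
    have hgθ : g θ = k * g x + g r := by
      have := hadd (k * x) r (by positivity) hr0 (by linarith)
      rw [hmul k x hxpos.le (by linarith)] at this
      rw [← this]
      congr 1
      linarith
    have hθ' : θ / b * g b = k * g x + r / x * g x := by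
      have : b = N * x := by rw [hx]; field_simp
      rw [hgx, this, hr]
      field_simp
      ring
    have hgr : g r ≤ g x := hmono r x hr0 hrx hxb
    have hq : r / x ≤ 1 := (div_le_one hxpos).2 hrx
    have hq0 : 0 ≤ r / x := by positivity
    have h1 : r / x * g x ≤ g x := mul_le_of_le_one_left (hnn x) hq
    have h2 : 0 ≤ r / x * g x := mul_nonneg hq0 (hnn x)
    have h3 : g b / N = g x := by rw [hgx]; field_simp
    rw [hgθ, hθ', h3, abs_le]
    constructor <;> linarith [hnn r]
  have hlim : Filter.Tendsto (fun n : ℕ => g b / ((n : ℝ) + 1)) Filter.atTop (nhds 0) := by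
    have := (tendsto_one_div_add_atTop_nhds_zero_nat (𝕜 := ℝ)).const_mul (g b)
    simpa [div_eq_mul_inv] using this
  have := ge_of_tendsto' hlim key
  exact sub_eq_zero.1 (abs_nonpos_iff.1 this)

variable {E : Type*} [NormedAddCommGroup E] [InnerProductSpace ℝ E]

/-- The unit forms which take values of opposite signs at `a` and `b`. -/
def signChangeSet (a b : E) : Set (sphere (0 : E) 1) :=
  {Φ | inner ℝ (Φ : E) a * inner ℝ (Φ : E) b < 0}

theorem signChangeSet_comm (a b : E) : signChangeSet a b = signChangeSet b a := by
  simp only [signChangeSet, mul_comm]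

theorem signChangeSet_self (a : E) : signChangeSet a a = ∅ := by
  ext Φ
  simp [signChangeSet, mul_self_nonneg]

theorem measurableSet_signChange_coe [MeasurableSpace E] [BorelSpace E] (a b : E) :
    MeasurableSet {x : E | inner ℝ x a * inner ℝ x b < 0} :=
  (isOpen_lt (f := fun x : E => inner ℝ x a * inner ℝ x b) (by fun_prop)
    continuous_const).measurableSet

theorem measurableSet_signChangeSet [MeasurableSpace E] [BorelSpace E] (a b : E) :
    MeasurableSet (signChangeSet a b) :=
  measurable_subtype_coe (measurableSet_signChange_coe a b)

/-- The unit circle in the plane of an orthonormal pair. -/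
noncomputable def planeCircle (e f : E) (θ : ℝ) : E := Real.cos θ • e + Real.sin θ • f

theorem inner_planeCircle {e f : E} (he : ‖e‖ = 1) (hf : ‖f‖ = 1) (hef : inner ℝ e f = 0)
    (α β : ℝ) : inner ℝ (planeCircle e f α) (planeCircle e f β) = Real.cos (α - β) := by
  have hfe : inner ℝ f e = 0 := by rw [real_inner_comm, hef]
  simp only [planeCircle, inner_add_left, inner_add_right, inner_smul_left, inner_smul_right,
    real_inner_self_eq_norm_sq, he, hf, hef, hfe, Real.cos_sub, conj_trivial]
  ring

theorem norm_planeCircle {e f : E} (he : ‖e‖ = 1) (hf : ‖f‖ = 1) (hef : inner ℝ e f = 0)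
    (α : ℝ) : ‖planeCircle e f α‖ = 1 := by
  rw [← sq_eq_sq₀ (norm_nonneg _) zero_le_one, ← real_inner_self_eq_norm_sq,
    inner_planeCircle he hf hef]
  simp

theorem reflection_planeCircle {e f : E} (he : ‖e‖ = 1) (hf : ‖f‖ = 1) (hef : inner ℝ e f = 0)
    (β θ : ℝ) : (Submodule.span ℝ {planeCircle e f (β / 2)}).reflection (planeCircle e f θ) =
      planeCircle e f (β - θ) := by
  rw [Submodule.reflection_singleton_apply, inner_planeCircle he hf hef,
    norm_planeCircle he hf hef]
  obtain ⟨δ, rfl⟩ : ∃ δ, θ = β / 2 + δ := ⟨θ - β / 2, by ring⟩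
  have h1 : β / 2 - (β / 2 + δ) = -δ := by ring
  have h2 : β - (β / 2 + δ) = β / 2 - δ := by ring
  rw [h1, h2]
  simp only [planeCircle, Real.cos_neg, Real.cos_add, Real.sin_add, Real.cos_sub, Real.sin_sub,
    RCLike.ofReal_one, one_pow, div_one]
  module

variable [FiniteDimensional ℝ E] [MeasurableSpace E] [BorelSpace E]

/-- The reflection fixing the direction at angle `β / 2` acts on the plane as `θ ↦ β - θ`, so it
takes the pair `(α, β)` to `(β - α, 0)`, and it preserves area. -/
theorem toSphere_signChange_planeCircle_sub {e f : E} (he : ‖e‖ = 1) (hf : ‖f‖ = 1)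
    (hef : inner ℝ e f = 0) (α β : ℝ) :
    (volume : Measure E).toSphere (signChangeSet (planeCircle e f α) (planeCircle e f β)) =
    (volume : Measure E).toSphere
      (signChangeSet (planeCircle e f 0) (planeCircle e f (β - α))) := by
  set L := (Submodule.span ℝ {planeCircle e f (β / 2)}).reflection
  rw [signChangeSet_comm (planeCircle e f 0)]
  have := toSphere_preimage_isometry L
    (measurableSet_signChange_coe (planeCircle e f (β - α)) (planeCircle e f 0))
  refine Eq.trans ?_ this
  congr 1
  ext Φ
  have h1 := reflection_planeCircle he hf hef β α
  have h2 := reflection_planeCircle he hf hef β β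
  rw [sub_self] at h2
  simp only [signChangeSet, Set.mem_ofPred_eq, Set.mem_preimage, ← h1, ← h2]
  rw [LinearIsometryEquiv.inner_map_map, LinearIsometryEquiv.inner_map_map]

/-- On an arc of length at most `π`, a linear form nonzero at the middle point changes sign between
the endpoints exactly when it does so on one of the two subarcs, and never on both. -/
theorem toSphere_signChange_planeCircle_add {e f : E} (he : ‖e‖ = 1) (hf : ‖f‖ = 1)
    (hef : inner ℝ e f = 0) {α β : ℝ} (hα : 0 < α) (hβ : 0 < β) (hαβ : α + β ≤ Real.pi) :
    (volume : Measure E).toSphere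
      (signChangeSet (planeCircle e f 0) (planeCircle e f (α + β))) =
    (volume : Measure E).toSphere (signChangeSet (planeCircle e f 0) (planeCircle e f α)) +
      (volume : Measure E).toSphere (signChangeSet (planeCircle e f 0) (planeCircle e f β)) := by
  have hβ' := toSphere_signChange_planeCircle_sub he hf hef α (α + β)
  rw [add_sub_cancel_left] at hβ'
  have hsα : 0 < Real.sin α := Real.sin_pos_of_pos_of_lt_pi hα (by linarith)
  have hsβ : 0 < Real.sin β := Real.sin_pos_of_pos_of_lt_pi hβ (by linarith)
  have hsab : 0 ≤ Real.sin (α + β) := Real.sin_nonneg_of_nonneg_of_le_pi (by linarith) hαβ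
  -- The middle vector, scaled by `sin (α + β) ≥ 0`, is a combination of the end vectors with
  -- positive coefficients; for `α + β = π` the left side vanishes and the ends are opposite.
  have hcomb : ∀ x : E, Real.sin (α + β) * inner ℝ x (planeCircle e f α) =
      Real.sin β * inner ℝ x (planeCircle e f 0) +
        Real.sin α * inner ℝ x (planeCircle e f (α + β)) := by
    intro x
    simp only [planeCircle, inner_add_right, inner_smul_right, Real.sin_add, Real.cos_add,
      Real.cos_zero, Real.sin_zero]
    linear_combination (Real.sin β * inner ℝ x e) * Real.sin_sq_add_cos_sq α
  have hdisj : Disjoint (signChangeSet (planeCircle e f 0) (planeCircle e f α))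
      (signChangeSet (planeCircle e f α) (planeCircle e f (α + β))) := by
    rw [Set.disjoint_left]
    intro Φ h1 h2
    simp only [signChangeSet, Set.mem_ofPred_eq] at h1 h2
    have hc := hcomb Φ
    rcases mul_neg_iff.1 h1 with ⟨hx, hy⟩ | ⟨hx, hy⟩
    · have hz := pos_of_mul_neg_right h2 hy.le
      nlinarith [mul_pos hsβ hx, mul_pos hsα hz, mul_nonneg hsab (neg_nonneg.2 hy.le)]
    · have hz : inner ℝ (Φ : E) (planeCircle e f (α + β)) < 0 := neg_of_mul_neg_right h2 hy.le
      nlinarith [mul_pos hsβ (neg_pos.2 hx), mul_pos hsα (neg_pos.2 hz), mul_nonneg hsab hy.le]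
  rw [← hβ', ← measure_union hdisj (measurableSet_signChangeSet _ _)]
  apply measure_congr
  filter_upwards [ae_toSphere_inner_ne_zero (norm_planeCircle he hf hef α)] with Φ hΦ
  apply propext
  change (_ : ℝ) < _ ↔ (_ : ℝ) < _ ∨ (_ : ℝ) < _
  have hc := hcomb Φ
  rcases lt_or_gt_of_ne hΦ with hy | hy
  · constructor
    · intro h
      rcases mul_neg_iff.1 h with ⟨hx, hz⟩ | ⟨hx, hz⟩
      · exact Or.inl (mul_neg_of_pos_of_neg hx hy)
      · exact Or.inr (mul_neg_of_neg_of_pos hy hz)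
    · rintro (h | h)
      · have hx := pos_of_mul_neg_left h hy.le
        have hz : inner ℝ (Φ : E) (planeCircle e f (α + β)) < 0 := by
          nlinarith [mul_pos hsβ hx, mul_nonneg hsab (neg_nonneg.2 hy.le)]
        exact mul_neg_of_pos_of_neg hx hz
      · have hz := pos_of_mul_neg_right h hy.le
        have hx : inner ℝ (Φ : E) (planeCircle e f 0) < 0 := by
          nlinarith [mul_pos hsα hz, mul_nonneg hsab (neg_nonneg.2 hy.le)]
        exact mul_neg_of_neg_of_pos hx hz
  · constructor
    · intro h
      rcases mul_neg_iff.1 h with ⟨hx, hz⟩ | ⟨hx, hz⟩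
      · exact Or.inr (mul_neg_of_pos_of_neg hy hz)
      · exact Or.inl (mul_neg_of_neg_of_pos hx hy)
    · rintro (h | h)
      · have hx := neg_of_mul_neg_left h hy.le
        have hz : 0 < inner ℝ (Φ : E) (planeCircle e f (α + β)) := by
          nlinarith [mul_pos hsβ (neg_pos.2 hx), mul_nonneg hsab hy.le]
        exact mul_neg_of_neg_of_pos hx hz
      · have hz := neg_of_mul_neg_right h hy.le
        have hx : 0 < inner ℝ (Φ : E) (planeCircle e f 0) := by
          nlinarith [mul_pos hsα (neg_pos.2 hz), mul_nonneg hsab hy.le]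
        exact mul_neg_of_pos_of_neg hx hz

theorem toSphere_signChange_neg {a : E} (ha : ‖a‖ = 1) :
    (volume : Measure E).toSphere (signChangeSet a (-a)) =
      (volume : Measure E).toSphere univ := by
  apply measure_congr
  filter_upwards [ae_toSphere_inner_ne_zero ha] with Φ hΦ
  refine propext (iff_of_true ?_ trivial)
  change (_ : ℝ) < _
  rw [inner_neg_right]
  have := mul_self_pos.2 hΦ
  linarith

/-- The proportion of the unit sphere on which two unit vectors are separated is their angle
divided by `π`. -/
theorem toSphere_real_signChange {a b : E} (ha : ‖a‖ = 1) (hb : ‖b‖ = 1) :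
    (volume : Measure E).toSphere.real (signChangeSet a b) =
      InnerProductGeometry.angle a b / Real.pi * (volume : Measure E).toSphere.real univ := by
  have ha0 : a ≠ 0 := norm_ne_zero_iff.1 (by rw [ha]; exact one_ne_zero)
  have hb0 : b ≠ 0 := norm_ne_zero_iff.1 (by rw [hb]; exact one_ne_zero)
  set θ := InnerProductGeometry.angle a b with hθ
  have hcos : inner ℝ a b = Real.cos θ := by
    rw [InnerProductGeometry.cos_angle, ha, hb]; simp
  rcases (InnerProductGeometry.angle_nonneg a b).eq_or_lt with h | hpos
  · have hab : a = b := by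
      rw [← inner_eq_one_iff_of_norm_eq_one (𝕜 := ℝ) ha hb, hcos, hθ, ← h, Real.cos_zero]
    subst hab
    rw [signChangeSet_self, hθ, ← h]
    simp
  -- The angles `0` and `π` are treated apart: only otherwise do `a` and `b` span a plane and allow
  -- the Gram–Schmidt vector `f` below.
  rcases (InnerProductGeometry.angle_le_pi a b).eq_or_lt with h | hlt
  · have hab : a = -b := by
      rw [← inner_eq_one_iff_of_norm_eq_one (𝕜 := ℝ) ha (by rwa [norm_neg]), inner_neg_right,
        hcos, hθ, h, Real.cos_pi, neg_neg]
    obtain rfl : b = -a := by rw [hab, neg_neg]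
    rw [measureReal_def, toSphere_signChange_neg ha, hθ, h, div_self Real.pi_ne_zero, one_mul,
      measureReal_def]
  have hsin : 0 < Real.sin θ := Real.sin_pos_of_pos_of_lt_pi hpos hlt
  set f := (Real.sin θ)⁻¹ • (b - Real.cos θ • a) with hf
  have haf : inner ℝ a f = 0 := by
    rw [hf, inner_smul_right, inner_sub_right, inner_smul_right, real_inner_self_eq_norm_sq, ha,
      hcos]
    ring
  have hbf : b = planeCircle a f θ := by
    rw [planeCircle, hf, smul_smul, mul_inv_cancel₀ hsin.ne', one_smul]
    module
  have hfn : ‖f‖ = 1 := by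
    rw [hf, norm_smul, norm_inv, Real.norm_of_nonneg hsin.le, inv_mul_eq_one₀ hsin.ne',
      ← sq_eq_sq₀ hsin.le (norm_nonneg _), norm_sub_sq_real, inner_smul_right, norm_smul,
      real_inner_comm, hcos, ha, hb, Real.norm_eq_abs, mul_one, sq_abs, Real.sin_sq]
    ring
  have hzero : planeCircle a f 0 = a := by simp [planeCircle]
  have hpi : planeCircle a f Real.pi = -a := by simp [planeCircle]
  -- Linearity on `[0, π]` is normalized at `π`, where the two vectors are opposite and almost every
  -- form separates them.
  have hlin := eq_div_mul_of_additive_of_nonneg (b := Real.pi) (θ := θ)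
    (g := fun t => (volume : Measure E).toSphere.real
      (signChangeSet (planeCircle a f 0) (planeCircle a f t))) Real.pi_pos
    (by
      intro x y hx hy hxy
      rcases hx.eq_or_lt with rfl | hx
      · simp [signChangeSet_self]
      rcases hy.eq_or_lt with rfl | hy
      · simp [signChangeSet_self]
      simp only [measureReal_def]
      rw [toSphere_signChange_planeCircle_add ha hfn haf hx hy hxy, ENNReal.toReal_add] <;>
        exact measure_ne_top _ _)
    (fun x => measureReal_nonneg) hpos.le hlt.le
  simp only [hzero, hpi, ← hbf] at hlin
  rw [hlin]
  congr 1
  rw [measureReal_def, toSphere_signChange_neg ha, measureReal_def]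

end SignChange

/-! ### Counting simple zeros by dyadic sign changes -/

section DyadicCount

open Set Filter Topology

/-- The points of the partition of `[0, b]` into `2 ^ n` equal parts. -/
noncomputable def dyadicPoint (b : ℝ) (n k : ℕ) : ℝ := k * (b / 2 ^ n)

theorem dyadicPoint_zero (b : ℝ) (n : ℕ) : dyadicPoint b n 0 = 0 := by simp [dyadicPoint]

theorem dyadicPoint_last (b : ℝ) (n : ℕ) : dyadicPoint b n (2 ^ n) = b := by
  simp only [dyadicPoint, Nat.cast_pow, Nat.cast_ofNat]
  field_simp

theorem dyadicPoint_succ (b : ℝ) (n k : ℕ) :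
    dyadicPoint b n (k + 1) = dyadicPoint b n k + b / 2 ^ n := by
  simp only [dyadicPoint]; push_cast; ring

theorem dyadicPoint_two_mul (b : ℝ) (n k : ℕ) :
    dyadicPoint b (n + 1) (2 * k) = dyadicPoint b n k := by
  simp only [dyadicPoint]; push_cast; rw [pow_succ]; field_simp

theorem dyadicPoint_mem_Icc {b : ℝ} (hb : 0 < b) {n k : ℕ} (hk : k ≤ 2 ^ n) :
    dyadicPoint b n k ∈ Icc 0 b := by
  refine ⟨by simp only [dyadicPoint]; positivity, ?_⟩
  refine le_trans ?_ (dyadicPoint_last b n).le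
  simp only [dyadicPoint]
  gcongr

theorem exists_dyadicPoint_le_lt {b : ℝ} (hb : 0 < b) (n : ℕ) {t : ℝ} (ht : t ∈ Ico 0 b) :
    ∃ k < 2 ^ n, dyadicPoint b n k ≤ t ∧ t < dyadicPoint b n (k + 1) := by
  have hh : 0 < b / 2 ^ n := by positivity
  refine ⟨⌊t / (b / 2 ^ n)⌋₊, ?_, ?_, ?_⟩
  · rw [Nat.floor_lt (by have := ht.1; positivity), div_lt_iff₀ hh]
    refine ht.2.trans_eq ?_
    push_cast
    field_simp
  · exact (le_div_iff₀ hh).1 (Nat.floor_le (by have := ht.1; positivity))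
  · have := (div_lt_iff₀ hh).1 (Nat.lt_floor_add_one (t / (b / 2 ^ n)))
    simpa [dyadicPoint] using this

theorem tendsto_dyadic_length (b : ℝ) : Tendsto (fun n : ℕ => b / 2 ^ n) atTop (𝓝 0) := by
  have := (tendsto_pow_atTop_nhds_zero_of_lt_one (r := (1 / 2 : ℝ)) (by norm_num)
    (by norm_num)).const_mul b
  simpa [div_eq_mul_inv] using this

open Classical in
/-- The number of sign changes of `f` along the `n`-th dyadic partition of `[0, b]`. -/
noncomputable def dyadicSignChanges (b : ℝ) (f : ℝ → ℝ) (n : ℕ) : ℕ :=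
  ((Finset.range (2 ^ n)).filter
    fun k => f (dyadicPoint b n k) * f (dyadicPoint b n (k + 1)) < 0).card

/-- A sign change over a cell persists over one of its halves as long as `f` is nonzero at the
midpoint; choosing that half injects the old cells into the new ones. -/
theorem monotone_dyadicSignChanges {b : ℝ} {f : ℝ → ℝ}
    (hd : ∀ n k, f (dyadicPoint b n k) ≠ 0) : Monotone (dyadicSignChanges b f) := by
  classical
  refine monotone_nat_of_le_succ fun n => ?_
  refine Finset.card_le_card_of_injOn (fun k => if f (dyadicPoint b (n + 1) (2 * k)) *
    f (dyadicPoint b (n + 1) (2 * k + 1)) < 0 then 2 * k else 2 * k + 1) ?_ ?_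
  · intro k hk
    simp only [Finset.coe_filter, Finset.mem_range, Set.mem_ofPred_eq] at hk ⊢
    obtain ⟨hk, hs⟩ := hk
    split_ifs with h
    · exact ⟨by rw [pow_succ]; omega, h⟩
    · refine ⟨by rw [pow_succ]; omega, ?_⟩
      rw [show 2 * k + 1 + 1 = 2 * (k + 1) by ring, dyadicPoint_two_mul]
      rw [dyadicPoint_two_mul] at h
      have h1 := hd n k
      have h2 := hd (n + 1) (2 * k + 1)
      have h3 : 0 < f (dyadicPoint b n k) * f (dyadicPoint b (n + 1) (2 * k + 1)) :=
        lt_of_le_of_ne (not_lt.1 h) (mul_ne_zero h1 h2).symm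
      rcases mul_pos_iff.1 h3 with ⟨hx, hy⟩ | ⟨hx, hy⟩
      · exact mul_neg_of_pos_of_neg hy (neg_of_mul_neg_right hs hx.le)
      · exact mul_neg_of_neg_of_pos hy (pos_of_mul_neg_right hs hx.le)
  · intro k _ j _ hkj
    dsimp only at hkj
    split_ifs at hkj <;> omega

/-- Infinitely many zeros would accumulate at a zero in `[0, b]`. It is not `b`, since `f b ≠ 0`,
and elsewhere a simple zero is isolated. -/
theorem finite_simple_zeros {b : ℝ} {f : ℝ → ℝ} (hf : Differentiable ℝ f) (hfb : f b ≠ 0)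
    (hs : ∀ t ∈ Ico 0 b, f t = 0 → deriv f t ≠ 0) : {t ∈ Ico 0 b | f t = 0}.Finite := by
  by_contra hinf
  obtain ⟨z, hz, hacc⟩ := Set.Infinite.exists_accPt_of_subset_isCompact (K := Icc 0 b) hinf
    isCompact_Icc (fun t ht => Ico_subset_Icc_self ht.1)
  rw [accPt_iff_frequently_nhdsNE] at hacc
  have hzero : f z = 0 := by
    have hcl : IsClosed {t : ℝ | f t = 0} := isClosed_eq hf.continuous continuous_const
    refine hcl.closure_subset (mem_closure_iff_frequently.2 ?_)
    exact (hacc.filter_mono nhdsWithin_le_nhds).mono fun t ht => ht.2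
  have hzb : z ∈ Ico 0 b := ⟨hz.1, lt_of_le_of_ne hz.2 fun h => hfb (h ▸ hzero)⟩
  have hne := (hf z).hasDerivAt.eventually_ne (c := 0) (hs z hzb hzero)
  obtain ⟨t, ht, hne⟩ := (hacc.and_eventually hne).exists
  exact hne ht.2

/-- The intermediate value theorem puts a zero in the open interior of each cell with a sign change,
and these interiors are disjoint. -/
theorem dyadicSignChanges_le {b : ℝ} (hb : 0 < b) {f : ℝ → ℝ} (hf : Continuous f)
    (hfin : {t ∈ Ico 0 b | f t = 0}.Finite) (n : ℕ) :
    dyadicSignChanges b f n ≤ {t ∈ Ico 0 b | f t = 0}.ncard := by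
  classical
  have hex : ∀ k : ℕ, ∃ z, f (dyadicPoint b n k) * f (dyadicPoint b n (k + 1)) < 0 →
      z ∈ Ioo (dyadicPoint b n k) (dyadicPoint b n (k + 1)) ∧ f z = 0 := by
    intro k
    by_cases h : f (dyadicPoint b n k) * f (dyadicPoint b n (k + 1)) < 0
    · have hle : dyadicPoint b n k ≤ dyadicPoint b n (k + 1) := by
        rw [dyadicPoint_succ]; have : 0 < b / 2 ^ n := by positivity
        linarith
      rcases mul_neg_iff.1 h with ⟨hx, hy⟩ | ⟨hx, hy⟩
      · obtain ⟨z, hz, h0⟩ := intermediate_value_Ioo' hle hf.continuousOn ⟨hy, hx⟩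
        exact ⟨z, fun _ => ⟨hz, h0⟩⟩
      · obtain ⟨z, hz, h0⟩ := intermediate_value_Ioo hle hf.continuousOn ⟨hx, hy⟩
        exact ⟨z, fun _ => ⟨hz, h0⟩⟩
    · exact ⟨0, fun h' => absurd h' h⟩
  choose z hz using hex
  rw [dyadicSignChanges, Set.ncard_eq_toFinset_card _ hfin]
  refine Finset.card_le_card_of_injOn z ?_ ?_
  · intro k hk
    simp only [Finset.coe_filter, Finset.mem_range, Set.mem_ofPred_eq] at hk
    obtain ⟨⟨h1, h2⟩, h0⟩ := hz k hk.2
    simp only [Finite.coe_toFinset, Set.mem_ofPred_eq]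
    exact ⟨⟨(dyadicPoint_mem_Icc hb hk.1.le).1.trans h1.le,
      h2.trans_le (dyadicPoint_mem_Icc hb hk.1).2⟩, h0⟩
  · intro k hk j hj hkj
    simp only [Finset.coe_filter, Finset.mem_range, Set.mem_ofPred_eq] at hk hj
    obtain ⟨⟨h1, h2⟩, -⟩ := hz k hk.2
    obtain ⟨⟨h3, h4⟩, -⟩ := hz j hj.2
    rw [hkj] at h1 h2
    have hh : 0 < b / 2 ^ n := by positivity
    have h5 := h1.trans h4
    have h6 := h3.trans h2
    simp only [dyadicPoint] at h5 h6
    have h7 := lt_of_mul_lt_mul_right h5 hh.le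
    have h8 := lt_of_mul_lt_mul_right h6 hh.le
    norm_cast at h7 h8
    omega

theorem exists_sign_change_of_simple_zero {f : ℝ → ℝ} {z : ℝ} (hf : DifferentiableAt ℝ f z)
    (hz : f z = 0) (hd : deriv f z ≠ 0) :
    ∃ δ > 0, ∀ x y, z - δ < x → x < z → z < y → y < z + δ → f x * f y < 0 := by
  -- Near `z` the slope has the sign of `deriv f z`; multiplying by that derivative treats both
  -- signs at once.
  have h := (hasDerivAt_iff_tendsto_slope.1 hf.hasDerivAt).mul_const (deriv f z)
  have h' := h.eventually (lt_mem_nhds (mul_self_pos.2 hd))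
  rw [eventually_nhdsWithin_iff, Metric.eventually_nhds_iff] at h'
  obtain ⟨δ, hδ, h'⟩ := h'
  refine ⟨δ, hδ, fun x y h1 h2 h3 h4 => ?_⟩
  have hx := h' (y := x) (by rw [Real.dist_eq, abs_lt]; constructor <;> linarith) h2.ne
  have hy := h' (y := y) (by rw [Real.dist_eq, abs_lt]; constructor <;> linarith) h3.ne'
  rw [slope_def_field, hz, sub_zero] at hx hy
  have hxy : 0 < (f x / (x - z)) * (f y / (y - z)) := by
    have := mul_pos hx hy
    have h5 : 0 < deriv f z * deriv f z := mul_self_pos.2 hd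
    rw [show f x / (x - z) * deriv f z * (f y / (y - z) * deriv f z) =
      (f x / (x - z)) * (f y / (y - z)) * (deriv f z * deriv f z) by ring] at this
    exact pos_of_mul_pos_left this h5.le
  have h6 : (x - z) * (y - z) < 0 := mul_neg_of_neg_of_pos (by linarith) (by linarith)
  have h7 : f x * f y = (x - z) * (y - z) * ((f x / (x - z)) * (f y / (y - z))) := by
    have : x - z ≠ 0 := by linarith
    have : y - z ≠ 0 := by linarith
    field_simp
  rw [h7]
  exact mul_neg_of_neg_of_pos h6 hxy

theorem eventually_ncard_le_dyadicSignChanges {b : ℝ} (hb : 0 < b) {f : ℝ → ℝ}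
    (hf : Differentiable ℝ f) (hd : ∀ n k, f (dyadicPoint b n k) ≠ 0)
    (hs : ∀ t ∈ Ico 0 b, f t = 0 → deriv f t ≠ 0)
    (hfin : {t ∈ Ico 0 b | f t = 0}.Finite) :
    ∀ᶠ n in atTop, {t ∈ Ico 0 b | f t = 0}.ncard ≤ dyadicSignChanges b f n := by
  classical
  -- The zeros being finite in number, a sufficiently fine mesh makes `f` change sign across each of
  -- them within one mesh length.
  have hev : ∀ᶠ n : ℕ in atTop, ∀ z ∈ {t ∈ Ico 0 b | f t = 0}, ∀ x y, z - b / 2 ^ n ≤ x →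
      x < z → z < y → y ≤ z + b / 2 ^ n → f x * f y < 0 := by
    rw [eventually_all_finite hfin]
    intro z hz
    obtain ⟨δ, hδ, h⟩ := exists_sign_change_of_simple_zero (hf z) hz.2 (hs z hz.1 hz.2)
    filter_upwards [(tendsto_dyadic_length b).eventually (gt_mem_nhds hδ)] with n hn x y h1 h2 h3 h4
    exact h x y (by linarith) h2 h3 (by linarith)
  filter_upwards [hev] with n hn
  have hex : ∀ z : ℝ, ∃ k, z ∈ {t ∈ Ico 0 b | f t = 0} →
      k < 2 ^ n ∧ dyadicPoint b n k < z ∧ z < dyadicPoint b n (k + 1) := by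
    intro z
    by_cases hz : z ∈ {t ∈ Ico 0 b | f t = 0}
    · obtain ⟨k, hk, h1, h2⟩ := exists_dyadicPoint_le_lt hb n hz.1
      exact ⟨k, fun _ => ⟨hk, lt_of_le_of_ne h1 fun h => hd n k (h ▸ hz.2), h2⟩⟩
    · exact ⟨0, fun h => absurd h hz⟩
  choose k hk using hex
  -- Two zeros `z < w` in one cell are impossible: the sign change at `z` forces a nonzero value at
  -- `w`.
  have hlt : ∀ z ∈ {t ∈ Ico 0 b | f t = 0}, ∀ w ∈ {t ∈ Ico 0 b | f t = 0}, k z = k w →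
      ¬ z < w := by
    intro z hz w hw hzw hlt
    obtain ⟨-, h1, h2⟩ := hk z hz
    obtain ⟨-, h3, h4⟩ := hk w hw
    rw [← hzw] at h4
    rw [dyadicPoint_succ] at h2 h4
    have := hn z hz (dyadicPoint b n (k z)) w (by linarith) h1 hlt (by linarith)
    rw [hw.2, mul_zero] at this
    exact lt_irrefl _ this
  rw [dyadicSignChanges, Set.ncard_eq_toFinset_card _ hfin]
  refine Finset.card_le_card_of_injOn k ?_ ?_
  · intro z hz
    rw [Finite.coe_toFinset] at hz
    obtain ⟨h0, h1, h2⟩ := hk z hz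
    simp only [Finset.coe_filter, Finset.mem_range, Set.mem_ofPred_eq]
    refine ⟨h0, hn z hz _ _ ?_ h1 h2 ?_⟩ <;> rw [dyadicPoint_succ] at * <;> linarith
  · intro z hz w hw hzw
    rw [Finite.coe_toFinset] at hz hw
    exact le_antisymm (not_lt.1 (hlt w hw z hz hzw.symm)) (not_lt.1 (hlt z hz w hw hzw))

theorem tendsto_dyadicSignChanges {b : ℝ} (hb : 0 < b) {f : ℝ → ℝ}
    (hf : Differentiable ℝ f) (hd : ∀ n k, f (dyadicPoint b n k) ≠ 0)
    (hs : ∀ t ∈ Ico 0 b, f t = 0 → deriv f t ≠ 0)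
    (hfin : {t ∈ Ico 0 b | f t = 0}.Finite) :
    ∀ᶠ n in atTop, dyadicSignChanges b f n = {t ∈ Ico 0 b | f t = 0}.ncard := by
  filter_upwards [eventually_ncard_le_dyadicSignChanges hb hf hd hs hfin] with n hn
  exact le_antisymm (dyadicSignChanges_le hb hf.continuous hfin n) hn

end DyadicCount

/-! ### Length of a spherical curve by inscribed geodesic polygons -/

section ArcLength

open Set Filter Topology InnerProductGeometry

variable {E : Type*} [NormedAddCommGroup E] [InnerProductSpace ℝ E]

theorem norm_sub_eq_two_mul_sin_half_angle {a b : E} (ha : ‖a‖ = 1) (hb : ‖b‖ = 1) :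
    ‖a - b‖ = 2 * Real.sin (angle a b / 2) := by
  have h0 := angle_nonneg a b
  have hpi := angle_le_pi a b
  have hs : 0 ≤ Real.sin (angle a b / 2) :=
    Real.sin_nonneg_of_nonneg_of_le_pi (by linarith) (by linarith)
  have hcos : inner ℝ a b = Real.cos (angle a b) := by
    rw [cos_angle, ha, hb]; simp
  rw [← sq_eq_sq₀ (norm_nonneg _) (by positivity), norm_sub_sq_real, ha, hb, hcos]
  have h1 := Real.cos_two_mul (angle a b / 2)
  rw [mul_div_cancel₀ _ two_ne_zero] at h1
  have h2 := Real.sin_sq_add_cos_sq (angle a b / 2)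
  linear_combination (-2) * h1 - 4 * h2

theorem norm_sub_le_angle {a b : E} (ha : ‖a‖ = 1) (hb : ‖b‖ = 1) : ‖a - b‖ ≤ angle a b := by
  rw [norm_sub_eq_two_mul_sin_half_angle ha hb]
  have := Real.sin_le (x := angle a b / 2) (by linarith [angle_nonneg a b])
  linarith

/-- With half-angle `x` the chord is `2 sin x`. The cubic bound for the sine handles `x ≤ 1`; for `x
≥ 1` Jordan's inequality already makes the quadratic term large enough. -/
theorem angle_le_norm_sub_add_sq {a b : E} (ha : ‖a‖ = 1) (hb : ‖b‖ = 1) :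
    angle a b ≤ ‖a - b‖ + 2 * ‖a - b‖ ^ 2 := by
  rw [norm_sub_eq_two_mul_sin_half_angle ha hb]
  have h0 := angle_nonneg a b
  have hpi := angle_le_pi a b
  obtain ⟨x, hx⟩ : ∃ x, angle a b = 2 * x := ⟨angle a b / 2, by ring⟩
  rw [hx] at h0 hpi ⊢
  rw [mul_div_cancel_left₀ x two_ne_zero]
  have hx0 : 0 ≤ x := by linarith
  have hj := Real.mul_le_sin hx0 (by linarith)
  have hs : x ≤ 2 * Real.sin x := by
    have : (1 : ℝ) / 2 ≤ 2 / Real.pi := by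
      rw [div_le_div_iff₀ two_pos Real.pi_pos]; linarith [Real.pi_le_four]
    nlinarith
  rcases hx0.eq_or_lt with rfl | hpos
  · simp
  rcases le_total x 1 with h1 | h1
  · have h2 := Real.sin_gt_sub_cube hpos
    have h3 : x ^ 3 ≤ x ^ 2 := pow_le_pow_of_le_one hx0 h1 (by norm_num)
    nlinarith
  · nlinarith

/-- The second order bounds for a smooth curve on a compact interval. -/
theorem exists_taylor_bounds {T : ℝ → E} (hT : ContDiff ℝ 2 T) (b : ℝ) :
    ∃ K : ℝ, 0 ≤ K ∧ ∀ s ∈ Icc 0 b, ∀ t ∈ Icc 0 b, ‖T t - T s‖ ≤ K * |t - s| ∧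
      ‖deriv T t - deriv T s‖ ≤ K * |t - s| ∧
      ‖T t - T s - (t - s) • deriv T s‖ ≤ K * (t - s) ^ 2 := by
  have hd : Differentiable ℝ T := hT.differentiable (by norm_num)
  have hT1 : ContDiff ℝ 1 (deriv T) := ((contDiff_succ_iff_deriv (n := 1)).1 hT).2.2
  have hd1 : Differentiable ℝ (deriv T) := hT1.differentiable (by norm_num)
  have hc1 : Continuous (deriv T) := hT1.continuous
  have hc2 : Continuous (deriv (deriv T)) := hT1.continuous_deriv le_rfl
  obtain ⟨K1, hK1⟩ := isCompact_Icc.exists_bound_of_continuousOn (s := Icc 0 b) hc1.continuousOn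
  obtain ⟨K2, hK2⟩ := isCompact_Icc.exists_bound_of_continuousOn (s := Icc 0 b) hc2.continuousOn
  set K := max 0 (max K1 K2) with hK
  have hK0 : 0 ≤ K := le_max_left _ _
  have hb1 : ∀ t ∈ Icc 0 b, ‖deriv T t‖ ≤ K := fun t ht =>
    (hK1 t ht).trans ((le_max_left _ _).trans (le_max_right _ _))
  have hb2 : ∀ t ∈ Icc 0 b, ‖deriv (deriv T) t‖ ≤ K := fun t ht =>
    (hK2 t ht).trans ((le_max_right _ _).trans (le_max_right _ _))
  have hL : ∀ s ∈ Icc 0 b, ∀ t ∈ Icc 0 b, ‖deriv T t - deriv T s‖ ≤ K * |t - s| :=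
    fun s hs t ht => (convex_Icc 0 b).norm_image_sub_le_of_norm_deriv_le
      (fun x _ => hd1 x) hb2 hs ht
  refine ⟨K, hK0, fun s hs t ht => ⟨(convex_Icc 0 b).norm_image_sub_le_of_norm_deriv_le
      (fun x _ => hd x) hb1 hs ht, hL s hs t ht, ?_⟩⟩
  -- The first order remainder is bounded by the mean value inequality for `T x - x • T' s`, whose
  -- derivative is small by the Lipschitz bound on `T'`.
  have hder : ∀ x, HasDerivAt (fun x => T x - x • deriv T s) (deriv T x - deriv T s) x := by
    intro x
    have := (hd x).hasDerivAt.sub ((hasDerivAt_id x).smul_const (deriv T s))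
    rw [one_smul] at this
    exact this
  have := (convex_uIcc s t).norm_image_sub_le_of_norm_deriv_le (C := K * |t - s|)
    (fun x _ => (hder x).differentiableAt)
    (fun x hx => by
      rw [(hder x).deriv]
      refine (hL s hs x (ordConnected_Icc.uIcc_subset hs ht hx)).trans ?_
      exact mul_le_mul_of_nonneg_left (abs_sub_left_of_mem_uIcc hx) hK0) left_mem_uIcc right_mem_uIcc
  calc ‖T t - T s - (t - s) • deriv T s‖
      = ‖T t - t • deriv T s - (T s - s • deriv T s)‖ := by congr 1; module
    _ ≤ K * |t - s| * ‖t - s‖ := this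
    _ = K * (t - s) ^ 2 := by rw [Real.norm_eq_abs, mul_assoc, abs_mul_abs_self, sq]

theorem exists_abs_angle_sub_integral_le {T : ℝ → E} (hT : ContDiff ℝ 2 T)
    (hn : ∀ t, ‖T t‖ = 1) (b : ℝ) :
    ∃ C : ℝ, 0 ≤ C ∧ ∀ s ∈ Icc 0 b, ∀ t ∈ Icc 0 b, s ≤ t →
      |angle (T s) (T t) - ∫ x in s..t, ‖deriv T x‖| ≤ C * (t - s) ^ 2 := by
  obtain ⟨K, hK0, hK⟩ := exists_taylor_bounds hT b
  -- The term `2 * K ^ 2` bounds angle minus chord; one `K` bounds chord minus `(t - s) * ‖T' s‖`,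
  -- the other `K` that product minus the integral.
  refine ⟨2 * K ^ 2 + 2 * K, by positivity, fun s hs t ht hst => ?_⟩
  have hc1 : Continuous (deriv T) := hT.continuous_deriv (by norm_num)
  obtain ⟨h1, -, h3⟩ := hK s hs t ht
  have hts : |t - s| = t - s := abs_of_nonneg (by linarith)
  rw [hts] at h1
  have hang : |angle (T s) (T t) - ‖T t - T s‖| ≤ 2 * K ^ 2 * (t - s) ^ 2 := by
    have ha := norm_sub_le_angle (hn s) (hn t)
    have hb := angle_le_norm_sub_add_sq (hn s) (hn t)
    rw [norm_sub_rev] at ha hb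
    rw [abs_of_nonneg (by linarith)]
    have := pow_le_pow_left₀ (norm_nonneg _) h1 2
    rw [mul_pow] at this
    linarith
  have hchord : |‖T t - T s‖ - (t - s) * ‖deriv T s‖| ≤ K * (t - s) ^ 2 := by
    have := abs_norm_sub_norm_le (T t - T s) ((t - s) • deriv T s)
    rw [norm_smul, Real.norm_eq_abs, hts] at this
    exact this.trans h3
  have hint : |(t - s) * ‖deriv T s‖ - ∫ x in s..t, ‖deriv T x‖| ≤ K * (t - s) ^ 2 := by
    have e : (t - s) * ‖deriv T s‖ - ∫ x in s..t, ‖deriv T x‖ =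
        ∫ x in s..t, (‖deriv T s‖ - ‖deriv T x‖) := by
      rw [intervalIntegral.integral_sub intervalIntegrable_const
        (hc1.norm.intervalIntegrable _ _)]
      simp
    rw [e, ← Real.norm_eq_abs]
    refine (intervalIntegral.norm_integral_le_of_norm_le_const (C := K * (t - s)) ?_).trans ?_
    · intro x hx
      rw [uIoc_of_le hst] at hx
      have hxI : x ∈ Icc 0 b := ⟨hs.1.trans hx.1.le, hx.2.trans ht.2⟩
      refine (abs_norm_sub_norm_le _ _).trans ((hK x hxI s hs).2.1.trans ?_)
      gcongr
      rw [abs_of_nonpos (by linarith [hx.1])]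
      linarith [hx.2]
    · rw [hts]; exact le_of_eq (by ring)
  rw [abs_le] at *
  constructor <;> linarith [hang.1, hang.2, hchord.1, hchord.2, hint.1, hint.2]

/-- The length of a curve on the unit sphere is the limit of the lengths of inscribed geodesic
polygons. -/
theorem tendsto_sum_angle {T : ℝ → E} (hT : ContDiff ℝ 2 T) (hn : ∀ t, ‖T t‖ = 1) {b : ℝ}
    (hb : 0 < b) :
    Tendsto (fun n : ℕ => ∑ k ∈ Finset.range (2 ^ n),
      angle (T (dyadicPoint b n k)) (T (dyadicPoint b n (k + 1)))) atTop
      (𝓝 (∫ x in 0..b, ‖deriv T x‖)) := by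
  obtain ⟨C, hC0, hC⟩ := exists_abs_angle_sub_integral_le hT hn b
  have hc1 : Continuous (deriv T) := hT.continuous_deriv (by norm_num)
  rw [tendsto_iff_norm_sub_tendsto_zero]
  have hlim : Tendsto (fun n : ℕ => C * b * (b / 2 ^ n)) atTop (𝓝 0) := by
    simpa using (tendsto_dyadic_length b).const_mul (C * b)
  refine squeeze_zero (fun n => norm_nonneg _) (fun n => ?_) hlim
  have hsum : ∫ x in 0..b, ‖deriv T x‖ = ∑ k ∈ Finset.range (2 ^ n),
      ∫ x in dyadicPoint b n k..dyadicPoint b n (k + 1), ‖deriv T x‖ := by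
    rw [intervalIntegral.sum_integral_adjacent_intervals
      (fun k _ => hc1.norm.intervalIntegrable _ _), dyadicPoint_zero, dyadicPoint_last]
  rw [hsum, ← Finset.sum_sub_distrib]
  -- An error quadratic in the mesh, over `2 ^ n` cells, adds up to one linear in the mesh.
  calc _ ≤ ∑ k ∈ Finset.range (2 ^ n), C * (b / 2 ^ n) ^ 2 := by
        refine norm_sum_le_of_le _ fun k hk => ?_
        have hk := Finset.mem_range.1 hk
        have := hC _ (dyadicPoint_mem_Icc hb hk.le) _ (dyadicPoint_mem_Icc hb hk)
          (by rw [dyadicPoint_succ]; have : 0 < b / 2 ^ n := by positivity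
              linarith)
        rw [dyadicPoint_succ b n k, add_sub_cancel_left] at this
        rwa [dyadicPoint_succ b n k]
    _ = C * b * (b / 2 ^ n) := by
        rw [Finset.sum_const, Finset.card_range, nsmul_eq_mul]
        push_cast
        field_simp

end ArcLength

/-! ### Crofton's formula on the unit sphere -/

section Crofton

open Set Filter Topology InnerProductGeometry Metric

variable {E : Type*} [NormedAddCommGroup E] [InnerProductSpace ℝ E]
  [MeasurableSpace E] [BorelSpace E]

theorem measurable_dyadicSignChanges (T : ℝ → E) (b : ℝ) (n : ℕ) :
    Measurable fun Φ : sphere (0 : E) 1 =>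
      (dyadicSignChanges b (fun t => inner ℝ (Φ : E) (T t)) n : ENNReal) := by
  classical
  simp only [dyadicSignChanges, Finset.card_filter]
  push_cast
  refine Finset.measurable_sum _ fun k _ => ?_
  exact Measurable.ite (measurableSet_signChangeSet (T (dyadicPoint b n k))
    (T (dyadicPoint b n (k + 1)))) measurable_const measurable_const

variable [FiniteDimensional ℝ E]

/-- Almost every hyperplane meets a smooth curve on the unit sphere transversally. -/
theorem ae_toSphere_simple_zeros {T : ℝ → E} (hT : ContDiff ℝ 2 T) (hn : ∀ t, ‖T t‖ = 1) {b : ℝ}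
    (hb : 0 < b) :
    ∀ᵐ Φ : sphere (0 : E) 1 ∂(volume : Measure E).toSphere,
      ∀ t ∈ Ico 0 b, inner ℝ (Φ : E) (T t) = 0 → inner ℝ (Φ : E) (deriv T t) ≠ 0 := by
  obtain ⟨K, hK0, hK⟩ := exists_taylor_bounds hT b
  set C := Module.finrank ℝ E * volume (ball (0 : E) 7) with hC
  have hCtop : C ≠ ⊤ := ENNReal.mul_ne_top (by simp) measure_ball_lt_top.ne
  set B : Set (sphere (0 : E) 1) := {Φ | ¬ ∀ t ∈ Ico 0 b,
    inner ℝ (Φ : E) (T t) = 0 → inner ℝ (Φ : E) (deriv T t) ≠ 0} with hB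
  have hle : ∀ n : ℕ, (volume : Measure E).toSphere B ≤
      ENNReal.ofReal ((K + 1) * b * (b / 2 ^ n)) * C := by
    intro n
    have hh : 0 < b / 2 ^ n := by positivity
    -- If `Φ` is tangent to the curve at `t`, Taylor's bound makes `⟨Φ, T⟩` quadratically small at
    -- the nearby dyadic point. So the bad forms lie in `2 ^ n` bands of width of order `4⁻ⁿ`. The
    -- constant is `K + 1` so that the width is positive even when `K = 0`.
    have hsub : B ⊆ ⋃ k ∈ Finset.range (2 ^ n), {Φ : sphere (0 : E) 1 |
        |inner ℝ (Φ : E) (T (dyadicPoint b n k))| ≤ (K + 1) * (b / 2 ^ n) ^ 2} := by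
      intro Φ hΦ
      simp only [hB, Set.mem_ofPred_eq] at hΦ
      push Not at hΦ
      obtain ⟨t, ht, h0, h1⟩ := hΦ
      obtain ⟨k, hk, hk1, hk2⟩ := exists_dyadicPoint_le_lt hb n ht
      simp only [Set.mem_iUnion, Finset.mem_range]
      refine ⟨k, hk, ?_⟩
      simp only [Set.mem_ofPred_eq]
      have h3 := (hK t (Ico_subset_Icc_self ht) _ (dyadicPoint_mem_Icc hb hk.le)).2.2
      set p := dyadicPoint b n k
      rw [dyadicPoint_succ] at hk2
      have hΦn : ‖(Φ : E)‖ = 1 := norm_eq_of_mem_sphere Φ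
      calc |inner ℝ (Φ : E) (T p)|
          = |inner ℝ (Φ : E) (T p - T t - (p - t) • deriv T t)| := by
            rw [inner_sub_right, inner_sub_right, inner_smul_right, h0, h1]; simp
        _ ≤ ‖(Φ : E)‖ * ‖T p - T t - (p - t) • deriv T t‖ := abs_real_inner_le_norm _ _
        _ ≤ K * (p - t) ^ 2 := by rw [hΦn, one_mul]; exact h3
        _ ≤ (K + 1) * (b / 2 ^ n) ^ 2 := by
            have : (p - t) ^ 2 ≤ (b / 2 ^ n) ^ 2 := by
              rw [← neg_sub, neg_sq]
              exact pow_le_pow_left₀ (by linarith) (by linarith) 2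
            gcongr
            linarith
    calc (volume : Measure E).toSphere B
        ≤ ∑ k ∈ Finset.range (2 ^ n), ENNReal.ofReal ((K + 1) * (b / 2 ^ n) ^ 2) * C := by
          refine (measure_mono hsub).trans ((measure_biUnion_finset_le _ _).trans ?_)
          exact Finset.sum_le_sum fun k _ => toSphere_band_le (hn _) (by positivity)
      _ = ENNReal.ofReal ((K + 1) * b * (b / 2 ^ n)) * C := by
          rw [Finset.sum_const, Finset.card_range, nsmul_eq_mul, ← mul_assoc,
            ← ENNReal.ofReal_natCast, ← ENNReal.ofReal_mul (Nat.cast_nonneg _)]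
          congr 2
          push_cast
          field_simp
  have hlim : Tendsto (fun n : ℕ => ENNReal.ofReal ((K + 1) * b * (b / 2 ^ n)) * C) atTop
      (𝓝 0) := by
    have h1 : Tendsto (fun n : ℕ => (K + 1) * b * (b / 2 ^ n)) atTop (𝓝 0) := by
      simpa using (tendsto_dyadic_length b).const_mul ((K + 1) * b)
    have h2 := ENNReal.Tendsto.mul_const (ENNReal.tendsto_ofReal h1) (Or.inr hCtop)
    simpa using h2
  exact le_antisymm (ge_of_tendsto' hlim hle) bot_le

theorem lintegral_dyadicSignChanges {T : ℝ → E} (hn : ∀ t, ‖T t‖ = 1) (b : ℝ) (n : ℕ) :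
    ∫⁻ Φ : sphere (0 : E) 1, (dyadicSignChanges b (fun t => inner ℝ (Φ : E) (T t)) n : ENNReal)
      ∂(volume : Measure E).toSphere =
    ENNReal.ofReal ((∑ k ∈ Finset.range (2 ^ n),
      angle (T (dyadicPoint b n k)) (T (dyadicPoint b n (k + 1)))) / Real.pi *
      (volume : Measure E).toSphere.real univ) := by
  classical
  have h : ∀ Φ : sphere (0 : E) 1,
      (dyadicSignChanges b (fun t => inner ℝ (Φ : E) (T t)) n : ENNReal) =
      ∑ k ∈ Finset.range (2 ^ n), (signChangeSet (T (dyadicPoint b n k))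
        (T (dyadicPoint b n (k + 1)))).indicator 1 Φ := by
    intro Φ
    rw [dyadicSignChanges, Finset.card_filter]
    push_cast
    exact Finset.sum_congr rfl fun k _ => by simp [Set.indicator_apply, signChangeSet]
  simp_rw [h]
  rw [lintegral_finsetSum _ fun k _ => measurable_one.indicator (measurableSet_signChangeSet _ _)]
  rw [Finset.sum_div, Finset.sum_mul, ENNReal.ofReal_sum_of_nonneg]
  · refine Finset.sum_congr rfl fun k _ => ?_
    rw [lintegral_indicator_one (measurableSet_signChangeSet _ _),
      ← toSphere_real_signChange (hn _) (hn _), measureReal_def,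
      ENNReal.ofReal_toReal (measure_ne_top _ _)]
  · intro k _
    have := angle_nonneg (T (dyadicPoint b n k)) (T (dyadicPoint b n (k + 1)))
    have := Real.pi_pos
    positivity

/-- Crofton's formula on the unit sphere: the mean number of intersections of a curve with a great
hypersphere is its length divided by `π`. -/
theorem crofton_sphere {T : ℝ → E} (hT : ContDiff ℝ 2 T) (hn : ∀ t, ‖T t‖ = 1) {b : ℝ}
    (hb : 0 < b) :
    (∀ᵐ Φ : sphere (0 : E) 1 ∂(volume : Measure E).toSphere,
      {t ∈ Ico 0 b | inner ℝ (Φ : E) (T t) = 0}.Finite) ∧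
    Integrable (fun Φ : sphere (0 : E) 1 => ({t ∈ Ico 0 b | inner ℝ (Φ : E) (T t) = 0}.ncard : ℝ))
      (volume : Measure E).toSphere ∧
    ∫ Φ : sphere (0 : E) 1, ({t ∈ Ico 0 b | inner ℝ (Φ : E) (T t) = 0}.ncard : ℝ)
      ∂(volume : Measure E).toSphere =
      (∫ x in 0..b, ‖deriv T x‖) / Real.pi * (volume : Measure E).toSphere.real univ := by
  have hTd : Differentiable ℝ T := hT.differentiable (by norm_num)
  have hder : ∀ (x : E) (t : ℝ), HasDerivAt (fun t => inner ℝ x (T t)) (inner ℝ x (deriv T t)) t :=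
    fun x t => by
      simpa using (hasDerivAt_const t x).inner ℝ (hTd t).hasDerivAt
  have hdiff : ∀ x : E, Differentiable ℝ fun t => inner ℝ x (T t) :=
    fun x t => (hder x t).differentiableAt
  have hdy : ∀ᵐ Φ : sphere (0 : E) 1 ∂(volume : Measure E).toSphere,
      ∀ n k, inner ℝ (Φ : E) (T (dyadicPoint b n k)) ≠ 0 := by
    rw [ae_all_iff]; intro n
    rw [ae_all_iff]; intro k
    exact ae_toSphere_inner_ne_zero (hn _)
  have hgood : ∀ᵐ Φ : sphere (0 : E) 1 ∂(volume : Measure E).toSphere,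
      (∀ n k, inner ℝ (Φ : E) (T (dyadicPoint b n k)) ≠ 0) ∧
      (∀ t ∈ Ico 0 b, inner ℝ (Φ : E) (T t) = 0 →
        deriv (fun t => inner ℝ (Φ : E) (T t)) t ≠ 0) ∧
      {t ∈ Ico 0 b | inner ℝ (Φ : E) (T t) = 0}.Finite := by
    filter_upwards [hdy, ae_toSphere_simple_zeros hT hn hb] with Φ h1 h2
    have h3 : ∀ t ∈ Ico 0 b, inner ℝ (Φ : E) (T t) = 0 →
        deriv (fun t => inner ℝ (Φ : E) (T t)) t ≠ 0 := fun t ht h0 => by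
      rw [(hder _ t).deriv]; exact h2 t ht h0
    refine ⟨h1, h3, finite_simple_zeros (hdiff _) ?_ h3⟩
    -- The last point of the trivial partition is the endpoint `b`, where finiteness of the zeros
    -- needs a nonzero value.
    have := h1 0 (2 ^ 0)
    rwa [dyadicPoint_last] at this
  have htend : ∀ᵐ Φ : sphere (0 : E) 1 ∂(volume : Measure E).toSphere, Tendsto (fun n =>
      (dyadicSignChanges b (fun t => inner ℝ (Φ : E) (T t)) n : ENNReal)) atTop
      (𝓝 ({t ∈ Ico 0 b | inner ℝ (Φ : E) (T t) = 0}.ncard : ENNReal)) := by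
    filter_upwards [hgood] with Φ ⟨h1, h2, h3⟩
    refine tendsto_const_nhds.congr' ?_
    filter_upwards [tendsto_dyadicSignChanges hb (hdiff Φ) h1 h2 h3] with n hn
    rw [hn]
  have hmono : ∀ᵐ Φ : sphere (0 : E) 1 ∂(volume : Measure E).toSphere, Monotone fun n =>
      (dyadicSignChanges b (fun t => inner ℝ (Φ : E) (T t)) n : ENNReal) := by
    filter_upwards [hdy] with Φ h1 n m hnm
    exact Nat.cast_le.2 (monotone_dyadicSignChanges h1 hnm)
  -- Monotone convergence of the sign-change counts; the same integrals are polygon lengths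
  -- converging to the length, and the two limits are then identified.
  have hlim := lintegral_tendsto_of_tendsto_of_monotone
    (fun n => (measurable_dyadicSignChanges T b n).aemeasurable) hmono htend
  simp_rw [lintegral_dyadicSignChanges hn] at hlim
  have hlim' := ENNReal.tendsto_ofReal (((tendsto_sum_angle hT hn hb).div_const Real.pi).mul_const
    ((volume : Measure E).toSphere.real univ))
  have hval := tendsto_nhds_unique hlim hlim'
  have hmeas := aemeasurable_of_tendsto_metrizable_ae atTop
    (fun n => (measurable_dyadicSignChanges T b n).aemeasurable) htend
  have hmeas' : AEStronglyMeasurable (fun Φ : sphere (0 : E) 1 =>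
      ({t ∈ Ico 0 b | inner ℝ (Φ : E) (T t) = 0}.ncard : ℝ)) (volume : Measure E).toSphere := by
    simpa using hmeas.ennreal_toReal.aestronglyMeasurable
  have hnn : 0 ≤ (∫ x in 0..b, ‖deriv T x‖) / Real.pi *
      (volume : Measure E).toSphere.real univ := by
    have : 0 ≤ ∫ x in 0..b, ‖deriv T x‖ :=
      intervalIntegral.integral_nonneg hb.le fun x _ => norm_nonneg _
    have := Real.pi_pos
    positivity
  refine ⟨hgood.mono fun Φ h => h.2.2, ⟨hmeas', ?_⟩, ?_⟩
  · rw [hasFiniteIntegral_iff_ofReal (Eventually.of_forall fun _ => Nat.cast_nonneg _)]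
    simp only [ENNReal.ofReal_natCast]
    rw [hval]
    exact ENNReal.ofReal_lt_top
  · rw [integral_eq_lintegral_of_nonneg_ae (Eventually.of_forall fun _ => Nat.cast_nonneg _) hmeas']
    simp only [ENNReal.ofReal_natCast]
    rw [hval, ENNReal.toReal_ofReal hnn]

end Crofton

/-! ### Immersions have injective differential -/

section Immersion

open Set Topology

variable {𝕜 : Type*} [NontriviallyNormedField 𝕜]
  {E F H G M N : Type*} [NormedAddCommGroup E] [NormedSpace 𝕜 E]
  [NormedAddCommGroup F] [NormedSpace 𝕜 F] [TopologicalSpace H] [TopologicalSpace G]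
  {I : ModelWithCorners 𝕜 E H} {J : ModelWithCorners 𝕜 F G}
  [TopologicalSpace M] [ChartedSpace H M] [TopologicalSpace N] [ChartedSpace G N] {n : ℕ∞ω}

/-- The differential of an immersion is injective. -/
theorem mfderiv_injective_of_isImmersionAt [I.Boundaryless] {f : M → N} {x : M} (hn : n ≠ 0)
    (h : IsImmersionAt I J n f x) : Function.Injective (mfderiv I J f x) := by
  set φ := h.domChart.extend I with hφ
  set ψ := h.codChart.extend J with hψ
  have hsrc : φ.source = h.domChart.source := h.domChart.extend_source
  -- In the charts the map is `u ↦ (u, 0)`. Projecting to the first factor and returning through the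
  -- domain chart gives a local left inverse, and the chain rule then yields injectivity.
  have heq : ∀ y ∈ h.domChart.source, φ.symm (h.equiv.symm (ψ (f y))).1 = y := by
    intro y hy
    have hy' : y ∈ φ.source := hsrc ▸ hy
    have h1 := h.writtenInCharts (φ.map_source hy')
    simp only [Function.comp_apply] at h1
    rw [φ.left_inv hy'] at h1
    rw [h1, ContinuousLinearEquiv.symm_apply_apply, φ.left_inv hy']
  have hxs := h.mem_domChart_source
  have hx1 : (h.equiv.symm (ψ (f x))).1 = φ x := by
    have hy' : x ∈ φ.source := hsrc ▸ hxs
    have h1 := h.writtenInCharts (φ.map_source hy')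
    simp only [Function.comp_apply] at h1
    rw [φ.left_inv hy'] at h1
    rw [h1, ContinuousLinearEquiv.symm_apply_apply]
  have hψd : MDifferentiableAt J 𝓘(𝕜, F) ψ (f x) :=
    (h.codChart.contMDiffAt_extend h.codChart_mem_maximalAtlas
      h.mem_codChart_source).mdifferentiableAt hn
  have hld : MDifferentiableAt J 𝓘(𝕜, E) (fun y => (h.equiv.symm (ψ y)).1) (f x) :=
    ((((ContinuousLinearMap.fst 𝕜 E h.complement).comp
      (h.equiv.symm : F →L[𝕜] E × h.complement)).differentiableAt).mdifferentiableAt).comp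
      (f x) hψd
  have hsd : MDifferentiableAt 𝓘(𝕜, E) I φ.symm (φ x) := by
    have h1 := contMDiffOn_extend_symm h.domChart_mem_maximalAtlas
    refine (h1.contMDiffAt ?_).mdifferentiableAt hn
    -- Without boundary, the extended chart has open target, so smoothness on it gives
    -- differentiability at the point.
    refine IsOpen.mem_nhds ?_ ⟨_, h.domChart.map_source hxs, rfl⟩
    exact I.toHomeomorph.isOpenMap _ h.domChart.open_target
  have hg : MDifferentiableAt J I (φ.symm ∘ fun y => (h.equiv.symm (ψ y)).1) (f x) := by
    refine MDifferentiableAt.comp (f x) ?_ hld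
    rw [hx1]
    exact hsd
  have hf : MDifferentiableAt I J f x := h.contMDiffAt.mdifferentiableAt hn
  have hcomp := mfderiv_comp x hg hf
  have hid : ((φ.symm ∘ fun y => (h.equiv.symm (ψ y)).1) ∘ f) =ᶠ[𝓝 x] id :=
    Filter.eventually_of_mem (h.domChart.open_source.mem_nhds hxs) heq
  rw [hid.mfderiv_eq, mfderiv_id] at hcomp
  intro v w hvw
  have hv := DFunLike.congr_fun hcomp v
  have hw := DFunLike.congr_fun hcomp w
  simp only [ContinuousLinearMap.comp_apply] at hv hw
  rw [hvw, ← hw] at hv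
  exact hv

end Immersion

/-! ### Calculus on the circle through its exponential parametrization -/

section CircleCalculus

open Set

variable {F : Type*} [NormedAddCommGroup F] [NormedSpace ℝ F]

theorem hasDerivAt_coe_circleExp (t : ℝ) :
    HasDerivAt (fun s : ℝ => (Circle.exp s : ℂ)) (Circle.exp t * Complex.I) t := by
  simp only [Circle.coe_exp]
  have := ((Complex.ofRealCLM.hasDerivAt (x := t)).mul_const Complex.I).cexp
  simpa using this

theorem mdifferentiableAt_circleExp (t : ℝ) : MDifferentiableAt 𝓘(ℝ, ℝ) (𝓡 1) Circle.exp t :=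
  (contMDiff_circleExp (m := 1)).mdifferentiableAt one_ne_zero

/-- The velocity of the exponential parametrization of the circle. -/
noncomputable def circleVelocity (t : ℝ) : EuclideanSpace ℝ (Fin 1) :=
  (mfderiv 𝓘(ℝ, ℝ) (𝓡 1) Circle.exp t : ℝ →L[ℝ] EuclideanSpace ℝ (Fin 1)) 1

/-- The differential of a map on the circle, as a linear map on the model space. -/
noncomputable def circleDeriv (f : Circle → F) (z : Circle) : EuclideanSpace ℝ (Fin 1) →L[ℝ] F :=
  mfderiv (𝓡 1) 𝓘(ℝ, F) f z

theorem hasDerivAt_comp_circleExp {f : Circle → F} {t : ℝ}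
    (hf : MDifferentiableAt (𝓡 1) 𝓘(ℝ, F) f (Circle.exp t)) :
    HasDerivAt (fun s => f (Circle.exp s)) (circleDeriv f (Circle.exp t) (circleVelocity t)) t := by
  have h := hf.hasMFDerivAt.comp t (mdifferentiableAt_circleExp t).hasMFDerivAt
  have h' : HasFDerivAt (fun s => f (Circle.exp s)) ((circleDeriv f (Circle.exp t)).comp
    (mfderiv 𝓘(ℝ, ℝ) (𝓡 1) Circle.exp t : ℝ →L[ℝ] EuclideanSpace ℝ (Fin 1))) t :=
    hasMFDerivAt_iff_hasFDerivAt.1 h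
  exact h'.hasDerivAt

/-- Composing with the inclusion into `ℂ` turns this velocity into `i e^{it}`, which is nonzero. -/
theorem circleVelocity_ne_zero (t : ℝ) : circleVelocity t ≠ 0 := by
  intro h0
  have : Fact (Module.finrank ℝ ℂ = 1 + 1) := finrank_real_complex_fact'
  have hc : MDifferentiableAt (𝓡 1) 𝓘(ℝ, ℂ) (fun z : Circle => (z : ℂ)) (Circle.exp t) :=
    ((contMDiff_coe_sphere (E := ℂ) (n := 1) (m := 1)).mdifferentiableAt one_ne_zero)
  have h := hasDerivAt_comp_circleExp hc
  rw [h0, map_zero] at h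
  have := h.unique (hasDerivAt_coe_circleExp t)
  exact mul_ne_zero (Circle.coe_ne_zero _) Complex.I_ne_zero this.symm

theorem exists_smul_circleVelocity (t : ℝ) (v : EuclideanSpace ℝ (Fin 1)) :
    ∃ c : ℝ, v = c • circleVelocity t := by
  have h : Module.finrank ℝ (EuclideanSpace ℝ (Fin 1)) = 1 := by simp
  obtain ⟨c, hc⟩ := (finrank_eq_one_iff_of_nonzero' (K := ℝ)
    (circleVelocity t) (circleVelocity_ne_zero t)).1 h v
  exact ⟨c, hc.symm⟩

theorem mfderiv_eq_zero_iff_deriv {f : Circle → F} {t : ℝ}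
    (hf : MDifferentiableAt (𝓡 1) 𝓘(ℝ, F) f (Circle.exp t)) :
    mfderiv (𝓡 1) 𝓘(ℝ, F) f (Circle.exp t) = 0 ↔ deriv (fun s => f (Circle.exp s)) t = 0 := by
  rw [(hasDerivAt_comp_circleExp hf).deriv]
  change circleDeriv f (Circle.exp t) = 0 ↔ _
  constructor
  · intro h; rw [h, zero_apply]
  · intro h
    ext v
    obtain ⟨c, rfl⟩ := exists_smul_circleVelocity t v
    simp [h]

theorem mfderiv_injective_iff_deriv_ne_zero {f : Circle → F} {t : ℝ}
    (hf : MDifferentiableAt (𝓡 1) 𝓘(ℝ, F) f (Circle.exp t)) :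
    Function.Injective (mfderiv (𝓡 1) 𝓘(ℝ, F) f (Circle.exp t)) ↔
      deriv (fun s => f (Circle.exp s)) t ≠ 0 := by
  rw [(hasDerivAt_comp_circleExp hf).deriv]
  change Function.Injective (circleDeriv f (Circle.exp t)) ↔ _
  constructor
  · intro h h0
    exact circleVelocity_ne_zero t (h (h0.trans (map_zero _).symm))
  · intro h
    rw [injective_iff_map_eq_zero]
    intro v hv
    obtain ⟨c, rfl⟩ := exists_smul_circleVelocity t v
    rw [map_smul] at hv
    rcases smul_eq_zero.1 hv with hc | hc
    · rw [hc, zero_smul]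
    · exact absurd hc h

/-- The half-open interval makes each point of the circle count once. -/
theorem bijOn_circleExp : BijOn Circle.exp (Ico 0 (2 * Real.pi)) univ := by
  refine ⟨fun _ _ => mem_univ _, ?_, ?_⟩
  · intro s hs t ht h
    obtain ⟨m, hm⟩ := Circle.exp_eq_exp.1 h
    have hpi := Real.two_pi_pos
    have h1 : (-1 : ℝ) < m := by nlinarith [hs.1, ht.2]
    have h2 : (m : ℝ) < 1 := by nlinarith [hs.2, ht.1]
    have : m = 0 := by
      have h1' : (-1 : ℤ) < m := by exact_mod_cast h1
      have h2' : m < (1 : ℤ) := by exact_mod_cast h2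
      omega
    rw [hm, this]; simp
  · intro z _
    refine ⟨toIcoMod Real.two_pi_pos 0 (Complex.arg z), ?_, ?_⟩
    · simpa using toIcoMod_mem_Ico Real.two_pi_pos 0 (Complex.arg z)
    · rw [toIcoMod, Circle.periodic_exp.sub_zsmul_eq, Circle.exp_arg]

theorem contDiff_comp_circleExp {f : Circle → F} {n : ℕ∞ω} (hf : ContMDiff (𝓡 1) 𝓘(ℝ, F) n f) :
    ContDiff ℝ n fun s => f (Circle.exp s) :=
  (hf.comp contMDiff_circleExp).contDiff

end CircleCalculus

/-! ### The Veronese map: explicit form, smoothness, regularity -/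

section Veronese

open Set

variable {ℓ : ℕ} {U : Type*} [NormedAddCommGroup U] [InnerProductSpace ℝ U]

/-- The power `v ↦ ∏ ⟨u, v_i⟩` of the linear form dual to `u`. -/
noncomputable def powForm (ℓ : ℕ) (u : U) : SymForm ℓ U :=
  ⟨(MultilinearMap.mkPiAlgebra ℝ (Fin ℓ) ℝ).compLinearMap fun _ => innerₛₗ ℝ u, by
    intro σ v
    simp only [MultilinearMap.compLinearMap_apply, MultilinearMap.mkPiAlgebra_apply]
    exact Equiv.prod_comp σ fun i => innerₛₗ ℝ u (v i)⟩

theorem powForm_apply (u : U) (v : Fin ℓ → U) : (powForm ℓ u).1 v = ∏ i, inner ℝ u (v i) := rfl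

variable [FiniteDimensional ℝ U]

theorem inner_symForm (Φ Ψ : SymForm ℓ U) :
    inner ℝ Φ Ψ = ∑ i : Fin ℓ → Fin (Module.finrank ℝ U),
      Φ.1 (fun k => stdOrthonormalBasis ℝ U (i k)) *
        Ψ.1 (fun k => stdOrthonormalBasis ℝ U (i k)) := rfl

/-- Expanding each argument `u` of `Φ` in the orthonormal basis produces exactly the defining sum of
the inner product. Hence the Veronese map is `powForm`. -/
theorem inner_powForm (Φ : SymForm ℓ U) (u : U) :
    inner ℝ Φ (powForm ℓ u) = Φ.1 fun _ => u := by
  rw [inner_symForm]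
  conv_rhs =>
    rw [← (stdOrthonormalBasis ℝ U).sum_repr' u, Φ.1.map_sum]
  refine Finset.sum_congr rfl fun i _ => ?_
  rw [Φ.1.map_smul_univ, powForm_apply, smul_eq_mul, mul_comm]
  simp only [real_inner_comm]

theorem veronese_eq_powForm (u : U) : veronese ℓ u = powForm ℓ u :=
  ext_inner_left ℝ fun Φ => by rw [inner_veronese, inner_powForm]

theorem contDiff_formPoly (Φ : SymForm ℓ U) {n : ℕ∞ω} : ContDiff ℝ n (formPoly Φ) := by
  have h : formPoly Φ = fun u => ∑ i : Fin ℓ → Fin (Module.finrank ℝ U),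
      Φ.1 (fun k => stdOrthonormalBasis ℝ U (i k)) *
        ∏ k, inner ℝ u (stdOrthonormalBasis ℝ U (i k)) :=
    funext fun u => (inner_powForm Φ u).symm
  rw [h]
  exact ContDiff.sum fun i _ => contDiff_const.mul
    (contDiff_prod fun k _ => contDiff_id.inner ℝ contDiff_const)

/-- The coordinates in an orthonormal basis of forms are the polynomials of the basis forms. -/
theorem contDiff_veronese {n : ℕ∞ω} : ContDiff ℝ n (veronese ℓ : U → SymForm ℓ U) := by
  have h : (veronese ℓ : U → SymForm ℓ U) = fun u =>
      ∑ i, formPoly (stdOrthonormalBasis ℝ (SymForm ℓ U) i) u •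
        stdOrthonormalBasis ℝ (SymForm ℓ U) i := by
    ext1 u
    conv_lhs => rw [← (stdOrthonormalBasis ℝ (SymForm ℓ U)).sum_repr' (veronese ℓ u)]
    exact Finset.sum_congr rfl fun i _ => by rw [inner_veronese]; rfl
  rw [h]
  exact ContDiff.sum fun i _ => (contDiff_formPoly _).smul contDiff_const

/-- The Veronese map preserves regularity of curves off the origin. -/
theorem deriv_veronese_comp_ne_zero (hℓ : 1 ≤ ℓ) {c : ℝ → U} {t : ℝ}
    (hc : DifferentiableAt ℝ c t) (h0 : c t ≠ 0) (hd : deriv c t ≠ 0) :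
    deriv (fun s => veronese ℓ (c s)) t ≠ 0 := by
  intro hz
  have hdiff : DifferentiableAt ℝ (fun s => veronese ℓ (c s)) t :=
    ((contDiff_veronese (n := 1)).differentiable one_ne_zero _).comp t hc
  have hder := hdiff.hasDerivAt
  rw [hz] at hder
  -- Pairing the curve with `powForm ℓ a` gives `⟨a, c⟩ ^ ℓ`; if the velocity vanishes, so does `ℓ
  -- ⟨a, c⟩ ^ (ℓ - 1) ⟨a, c'⟩`.
  have key : ∀ a : U, inner ℝ a (c t) ≠ 0 → inner ℝ a (deriv c t) = 0 := by
    intro a ha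
    have h1 : HasDerivAt (fun s => inner ℝ (powForm ℓ a) (veronese ℓ (c s))) 0 t := by
      simpa using (hasDerivAt_const t (powForm ℓ a)).inner ℝ hder
    have h2 : HasDerivAt (fun s => inner ℝ a (c s)) (inner ℝ a (deriv c t)) t := by
      simpa using (hasDerivAt_const t a).inner ℝ hc.hasDerivAt
    have h3 : (fun s => inner ℝ (powForm ℓ a) (veronese ℓ (c s))) =
        fun s => inner ℝ a (c s) ^ ℓ := by
      ext1 s
      rw [inner_veronese, powForm_apply]
      simp
    rw [h3] at h1
    have h4 := h1.unique (h2.pow ℓ)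
    have hℓ0 : (ℓ : ℝ) ≠ 0 := by exact_mod_cast (by omega : ℓ ≠ 0)
    have h5 := mul_ne_zero hℓ0 (pow_ne_zero (ℓ - 1) ha)
    exact (mul_eq_zero.1 h4.symm).resolve_left h5
  -- Taking `a = c` shows `c ⊥ c'`; then `a = c + c'` still pairs nontrivially with `c` and gives
  -- `‖c'‖² = 0`.
  have hu : inner ℝ (c t) (deriv c t) = 0 := key _ (by simpa using h0)
  have hw := key (c t + deriv c t) (by
    rw [inner_add_left, real_inner_comm (c t) (deriv c t), hu, add_zero]
    simpa using h0)
  rw [inner_add_left, hu, zero_add] at hw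
  exact hd (inner_self_eq_zero.1 hw)

/-- For linear forms the Veronese map is the isometry between a Euclidean space and its dual. -/
noncomputable def veroneseOne (U : Type*) [NormedAddCommGroup U] [InnerProductSpace ℝ U]
    [FiniteDimensional ℝ U] : U →ₗᵢ[ℝ] SymForm 1 U where
  toFun := veronese 1
  map_add' u v := by
    apply Subtype.ext
    ext w
    simp [veronese_eq_powForm, powForm_apply, inner_add_left]
  map_smul' r u := by
    apply Subtype.ext
    ext w
    simp [veronese_eq_powForm, powForm_apply, inner_smul_left]
  norm_map' u := by
    rw [← sq_eq_sq₀ (norm_nonneg _) (norm_nonneg _), ← real_inner_self_eq_norm_sq,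
      ← real_inner_self_eq_norm_sq]
    change inner ℝ (veronese 1 u) (veronese 1 u) = _
    rw [inner_veronese, veronese_eq_powForm, powForm_apply]
    simp

end Veronese

/-! ### Total curvature and the tangent indicatrix -/

section TotalCurvature

variable {E F : Type*} [NormedAddCommGroup E] [InnerProductSpace ℝ E]
  [NormedAddCommGroup F] [InnerProductSpace ℝ F]

theorem contDiff_unitTangent {c : ℝ → E} (hc : ContDiff ℝ ∞ c) (hd : ∀ t, deriv c t ≠ 0) :
    ContDiff ℝ ∞ (unitTangent c) := by
  have h : ContDiff ℝ ∞ (deriv c) := (contDiff_infty_iff_deriv.1 hc).2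
  exact ((h.norm ℝ hd).inv fun t => norm_ne_zero_iff.2 (hd t)).smul h

theorem norm_unitTangent {c : ℝ → E} {t : ℝ} (hd : deriv c t ≠ 0) : ‖unitTangent c t‖ = 1 := by
  rw [unitTangent, norm_smul, norm_inv, norm_norm, inv_mul_cancel₀ (norm_ne_zero_iff.2 hd)]

theorem inner_unitTangent_eq_zero_iff {c : ℝ → E} {t : ℝ} (hd : deriv c t ≠ 0) (x : E) :
    inner ℝ x (unitTangent c t) = 0 ↔ inner ℝ x (deriv c t) = 0 := by
  rw [unitTangent, inner_smul_right, mul_eq_zero,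
    or_iff_right (inv_ne_zero (norm_ne_zero_iff.2 hd))]

/-- The total curvature is the length of the tangent indicatrix. -/
theorem totalCurvature_eq_integral_norm_deriv {β : Circle → E}
    (hd : ∀ t, deriv (fun s => β (Circle.exp s)) t ≠ 0) :
    totalCurvature β = ∫ t in (0 : ℝ)..(2 * Real.pi),
      ‖deriv (unitTangent fun s => β (Circle.exp s)) t‖ := by
  refine intervalIntegral.integral_congr fun t _ => ?_
  simp only [curvature]
  rw [div_mul_cancel₀ _ (norm_ne_zero_iff.2 (hd t))]

theorem totalCurvature_linearIsometry_comp (L : E →ₗᵢ[ℝ] F) {β : Circle → E}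
    (hβ : ContDiff ℝ ∞ fun s => β (Circle.exp s))
    (hd : ∀ t, deriv (fun s => β (Circle.exp s)) t ≠ 0) :
    totalCurvature (L ∘ β) = totalCurvature β := by
  have hderiv : ∀ (c : ℝ → E) (t : ℝ), DifferentiableAt ℝ c t →
      deriv (fun s => L (c s)) t = L (deriv c t) := fun c t hc =>
    (L.toContinuousLinearMap.hasFDerivAt.comp_hasDerivAt t hc.hasDerivAt).deriv
  have h1 : deriv (fun s => (L ∘ β) (Circle.exp s)) =
      fun t => L (deriv (fun s => β (Circle.exp s)) t) :=
    funext fun t => hderiv _ t (hβ.differentiable (by simp) t)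
  have h2 : unitTangent (fun s => (L ∘ β) (Circle.exp s)) =
      fun t => L (unitTangent (fun s => β (Circle.exp s)) t) := by
    ext1 t
    simp only [unitTangent, h1, L.norm_map, map_smul]
  refine intervalIntegral.integral_congr fun t _ => ?_
  simp only [curvature, h1, h2, L.norm_map]
  rw [hderiv _ t ((contDiff_unitTangent hβ hd).differentiable (by simp) t), L.norm_map]

end TotalCurvature

/-! ### Critical points as zeros on the tangent indicatrix -/

section CriticalPoints

open Set

variable {ℓ : ℕ} {U : Type*} [NormedAddCommGroup U] [InnerProductSpace ℝ U]
  [FiniteDimensional ℝ U]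

/-- The critical points of a form on a knot correspond to the zeros of the form on the tangent
indicatrix of the Veronese curve. -/
theorem criticalPoints_eq_image {γ : Circle → U} (hγ : ContMDiff (𝓡 1) 𝓘(ℝ, U) ∞ γ)
    (hd : ∀ t, deriv (fun s => veronese ℓ (γ (Circle.exp s))) t ≠ 0) (Φ : SymForm ℓ U) :
    criticalPoints γ (formPoly Φ) = (γ ∘ Circle.exp) '' {t ∈ Ico 0 (2 * Real.pi) |
      inner ℝ Φ (unitTangent (fun s => veronese ℓ (γ (Circle.exp s))) t) = 0} := by
  have hc : ContDiff ℝ ∞ fun s => veronese ℓ (γ (Circle.exp s)) :=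
    contDiff_veronese.comp (contDiff_comp_circleExp hγ)
  have hcrit : ∀ t, mfderiv (𝓡 1) 𝓘(ℝ, ℝ) (formPoly Φ ∘ γ) (Circle.exp t) = 0 ↔
      inner ℝ Φ (unitTangent (fun s => veronese ℓ (γ (Circle.exp s))) t) = 0 := by
    intro t
    have hf : ContMDiff (𝓡 1) 𝓘(ℝ, ℝ) ∞ (formPoly Φ ∘ γ) :=
      (contDiff_formPoly Φ).contMDiff.comp hγ
    rw [mfderiv_eq_zero_iff_deriv (hf.mdifferentiableAt (by simp)),
      inner_unitTangent_eq_zero_iff (hd t)]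
    have h1 : (fun s => (formPoly Φ ∘ γ) (Circle.exp s)) =
        fun s => inner ℝ Φ (veronese ℓ (γ (Circle.exp s))) :=
      funext fun s => (inner_veronese _ Φ).symm
    have h2 : HasDerivAt (fun s => inner ℝ Φ (veronese ℓ (γ (Circle.exp s))))
        (inner ℝ Φ (deriv (fun s => veronese ℓ (γ (Circle.exp s))) t)) t := by
      simpa using (hasDerivAt_const t Φ).inner ℝ (hc.differentiable (by simp) t).hasDerivAt
    rw [h1, h2.deriv]
  rw [criticalPoints, image_comp]
  congr 1
  ext z
  obtain ⟨t, ht, rfl⟩ := bijOn_circleExp.surjOn (mem_univ z)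
  simp only [Set.mem_ofPred_eq, Set.mem_image]
  constructor
  · intro h
    exact ⟨t, ⟨ht, (hcrit t).1 h⟩, rfl⟩
  · rintro ⟨s, ⟨-, hs⟩, hst⟩
    rw [← hst]
    exact (hcrit s).2 hs

end CriticalPoints

end VeroneseKnot

/-! ### The main theorem -/

theorem theorem2p1 {U : Type*} [NormedAddCommGroup U] [InnerProductSpace ℝ U]
    [FiniteDimensional ℝ U]
    (γ : Circle → U) (hγ : IsSmoothEmbedding (𝓡 1) 𝓘(ℝ, U) ∞ γ)
    (h0 : (0 : U) ∉ Set.range γ)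
    (ℓ : ℕ) (hℓ : 1 ≤ ℓ) :
    -- the restriction of the Veronese map to the knot is a smooth immersion
    (ContMDiff (𝓡 1) 𝓘(ℝ, VeroneseKnot.SymForm ℓ U) ∞ (VeroneseKnot.veronese ℓ ∘ γ) ∧
      ∀ z : Circle, Function.Injective
        (mfderiv (𝓡 1) 𝓘(ℝ, VeroneseKnot.SymForm ℓ U) (VeroneseKnot.veronese ℓ ∘ γ) z)) ∧
    -- the number of critical points is almost surely finite and has finite expectation
    (∀ᵐ Φ ∂(VeroneseKnot.sphereArea ℓ U),
      (VeroneseKnot.criticalPoints γ (VeroneseKnot.formPoly Φ.1)).Finite) ∧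
    Integrable (fun Φ : Metric.sphere (0 : VeroneseKnot.SymForm ℓ U) 1 =>
      ((VeroneseKnot.criticalPoints γ (VeroneseKnot.formPoly Φ.1)).ncard : ℝ))
      (VeroneseKnot.sphereArea ℓ U) ∧
    VeroneseKnot.expectedCriticalPoints ℓ γ =
      VeroneseKnot.totalCurvature (VeroneseKnot.veronese ℓ ∘ γ) / Real.pi ∧
    -- for linear forms the invariant is the total curvature of the knot itself
    (ℓ = 1 → VeroneseKnot.totalCurvature (VeroneseKnot.veronese ℓ ∘ γ) =
      VeroneseKnot.totalCurvature γ) := by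
  have hsm : ContMDiff (𝓡 1) 𝓘(ℝ, U) ∞ γ := hγ.contMDiff
  have hγexp : ContDiff ℝ ∞ fun s => γ (Circle.exp s) := VeroneseKnot.contDiff_comp_circleExp hsm
  have hγd : ∀ t, deriv (fun s => γ (Circle.exp s)) t ≠ 0 := fun t =>
    (VeroneseKnot.mfderiv_injective_iff_deriv_ne_zero (hsm.mdifferentiableAt (by simp))).1
      (VeroneseKnot.mfderiv_injective_of_isImmersionAt (by simp) (hγ.isImmersion.isImmersionAt _))
  have hV : ContMDiff (𝓡 1) 𝓘(ℝ, VeroneseKnot.SymForm ℓ U) ∞ (VeroneseKnot.veronese ℓ ∘ γ) :=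
    VeroneseKnot.contDiff_veronese.contMDiff.comp hsm
  have hcd : ∀ t, deriv (fun s => VeroneseKnot.veronese ℓ (γ (Circle.exp s))) t ≠ 0 := fun t =>
    VeroneseKnot.deriv_veronese_comp_ne_zero hℓ (hγexp.differentiable (by simp) t)
      (fun h => h0 ⟨_, h⟩) (hγd t)
  have hc : ContDiff ℝ ∞ fun s => VeroneseKnot.veronese ℓ (γ (Circle.exp s)) :=
    VeroneseKnot.contDiff_comp_circleExp hV
  obtain ⟨hfin, hint, hval⟩ := VeroneseKnot.crofton_sphere
    ((VeroneseKnot.contDiff_unitTangent hc hcd).of_le (WithTop.coe_le_coe.2 le_top))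
    (fun t => VeroneseKnot.norm_unitTangent (hcd t)) Real.two_pi_pos
  -- Critical points are counted on the knot, zeros in the parameter; injectivity of the embedding
  -- makes the counts agree.
  have hinj : Set.InjOn (γ ∘ Circle.exp) (Set.Ico 0 (2 * Real.pi)) :=
    hγ.isEmbedding.injective.injOn.comp VeroneseKnot.bijOn_circleExp.injOn
      (Set.mapsTo_univ _ _)
  have hcard : ∀ Φ : VeroneseKnot.SymForm ℓ U,
      (VeroneseKnot.criticalPoints γ (VeroneseKnot.formPoly Φ)).ncard =
      {t ∈ Set.Ico 0 (2 * Real.pi) | inner ℝ Φ (VeroneseKnot.unitTangent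
        (fun s => VeroneseKnot.veronese ℓ (γ (Circle.exp s))) t) = 0}.ncard := fun Φ => by
    rw [VeroneseKnot.criticalPoints_eq_image hsm hcd,
      Set.InjOn.ncard_image (hinj.mono fun t ht => ht.1)]
  refine ⟨⟨hV, fun z => ?_⟩, ?_, ?_, ?_, ?_⟩
  · obtain ⟨t, -, rfl⟩ := VeroneseKnot.bijOn_circleExp.surjOn (Set.mem_univ z)
    exact (VeroneseKnot.mfderiv_injective_iff_deriv_ne_zero
      (hV.mdifferentiableAt (by simp))).2 (hcd t)
  · filter_upwards [hfin] with Φ hΦ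
    rw [VeroneseKnot.criticalPoints_eq_image hsm hcd]
    exact hΦ.image _
  · simp only [hcard]
    exact hint
  · have : Nontrivial (VeroneseKnot.SymForm ℓ U) := ⟨⟨_, _, hcd 0⟩⟩
    have hpos : (VeroneseKnot.sphereArea ℓ U).real Set.univ ≠ 0 := by
      rw [VeroneseKnot.sphereArea, measureReal_ne_zero_iff, Ne, Measure.measure_univ_eq_zero]
      exact Measure.toSphere_ne_zero _
    rw [VeroneseKnot.totalCurvature_eq_integral_norm_deriv hcd,
      VeroneseKnot.expectedCriticalPoints]
    simp only [hcard]
    change _ * (∫ Φ, _ ∂(volume : Measure (VeroneseKnot.SymForm ℓ U)).toSphere) = _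
    rw [hval, mul_comm]
    exact mul_div_cancel_right₀ _ hpos
  · rintro rfl
    exact VeroneseKnot.totalCurvature_linearIsometry_comp (VeroneseKnot.veroneseOne U) hγexp hγd
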